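/- **Setting.** Let $a,b,c$ be parameters with $b,c$ powers of $2$. The nodes are the pairs $(i,x)\in[0,a)\times[0,b)$. The propositional variables are the bits $(f_i(x))_j$ ($i<a-1$, $x<b$, $j<\log b$), the variables $G_i(x,y)$ ($i<a$, $x<b$, $y<c$; "node $(i,x)$ has colour $y$"), and the bits $(u(x))_j$ ($x<b$, $j<\log c$). A *restriction* is a partial assignment to these variables. A *path* in a restriction is a maximal sequence of nodes $(i,x_0),\dots,(i+m,x_m)$ with $f_{i+j}(x_j)=x_{j+1}$ for $0\le j<m$ (a single node is allowed). *Random restrictions.* For $p,q\in(0,1)$, a restriction is drawn from $\mathcal R_{p,q}$ as follows. For each $i<a-1$, every $x<b$ is put into a set $Z_i$ independently with probability $1-p$, and $f_i$ is a uniformly random injection from $Z_i$ into $[0,b)$ (unset outside $Z_i$). On the path beginning at $(0,0)$ all $G_i(x,y)$ are set to $0$. Every other path independently is left uncoloured with probability $q$, and with probability $1-q$ receives a uniformly random colour $y<c$, meaning that $G_i(x,y)=1$ and $G_i(x,y')=0$ for $y'\ne y$ at all its nodes $(i,x)$. If the path through a bottom node $(a-1,x)$ received the colour $y$, then $u(x)=y$;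 otherwise $u(x)$ is unset. *Legal and good.* A restriction is *legal* if every $f_i(x)$ has either all or none of its bits set; every $f_i$ is a partial injection; every path either has no colour variable set (no $G_i(x,y)$ at its nodes, and no bit of $u(x)$ if it contains $(a-1,x)$), or does not begin at $(0,0)$ and has exactly one colour $y$ at all its nodes (with $u(x)=y$ if it contains $(a-1,x)$), or begins at $(0,0)$ and has all $G_i(x,y)$ at its nodes set to $0$; and the path beginning at $(0,0)$ does not reach level $a-1$. For $a=b=n$, $p=n^{-4/7}$, $q=n^{-2/7}$, a restriction is *good* if it is legal; no path has more than $n^{5/7}$ nodes; for each $i<n-1$ the number of $x$ with $f_i(x)$ unset is between $\frac12 n^{3/7}$ and $2n^{3/7}$; and on each level at least $\frac12 n^{1/7}$ nodes begin an uncoloured path. Otherwise it is *bad*. *Fixing.* A restriction $\rho$ *fixes* a CNF $B$ *to* $0$ if in some clause of $B$ every literal is set to $0$ by $\rho$; it fixes $B$ *to* $1$ if no legal extension of $\rho$ fixes $B$ to $0$. A $k$-CNF is a CNF whose clauses have at most $k$ literals. **Lemma.** For all sufficiently large $n$ such that $n$ and $c=\lfloor n^{1/7}\rfloor$ are powers of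 $2$, the following holds with $a=b=n$, $p=n^{-4/7}$, $q=n^{-2/7}$ and $\rho\sim\mathcal R_{p,q}$ (how large $n$ must be does not depend on $k$, $d$ or the tree). Consider a complete binary decision tree of height $h$ in which each internal node is labelled with a $k$-CNF and has outgoing edges for NO ($0$) and YES ($1$) answers. A node $z$ and a restriction $\rho$ are *compatible* if $\rho$ is good and, for every CNF $B$ labelling a node strictly above $z$ on the path from the root to $z$, $\rho$ fixes $B$ to the value specified by the outgoing edge along the path. Let $\epsilon=\Pr[\rho\text{ is bad}]$; a node $z$ is *big* if $\Pr[\rho\text{ is compatible with }z]>\epsilon$. For $d\le h$ let $S_d$ be the set of good restrictions compatible with some big node at depth $d$. Then $$\Pr[S_d]\ \ge\ 1-d\cdot 12kn^{-1/7}-2^{d+1}\epsilon .$$ -/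

import Mathlib

open scoped NNReal ENNReal

namespace CPLS

/-! ### Variables, restrictions, CNFs -/

/-- The propositional variables describing the oracle of a CPLS instance with `a` levels, `b` nodes
on every level and `c` colours (`b` and `c` are intended to be powers of two):
* `f i x j` is the `j`-th bit of `f_i(x)`, for `i < a - 1`;
* `G i x y` says that node `(i, x)` has colour `y`;
* `u x j` is the `j`-th bit of `u(x)`. -/
inductive Var (a b c : ℕ) : Type
  | f (i : Fin (a - 1)) (x : Fin b) (j : Fin (Nat.log 2 b))
  | G (i : Fin a) (x : Fin b) (y : Fin c)
  | u (x : Fin b) (j : Fin (Nat.log 2 c))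

/-- Nodes `(i, x)` of the levelled graph. -/
abbrev Node (a b : ℕ) : Type := Fin a × Fin b

/-- A restriction is a partial assignment to the variables; `none` means unset. -/
abbrev Restriction (a b c : ℕ) : Type := Var a b c → Option Bool

/-- The literal `(v, true)` is the variable `v`, and `(v, false)` is its negation. -/
abbrev Literal (a b c : ℕ) : Type := Var a b c × Bool

/-- A CNF is a conjunction of clauses, a clause being a disjunction of literals. -/
abbrev CNF (a b c : ℕ) : Type := List (List (Literal a b c))

/-- A `k`-CNF: every clause has at most `k` literals. -/
def KCNF (a b c k : ℕ) : Type := {B : CNF a b c // ∀ C ∈ B, C.length ≤ k}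

variable {a b c : ℕ}

/-- `σ` extends `ρ`. -/
def Extends (σ ρ : Restriction a b c) : Prop :=
  ∀ v t, ρ v = some t → σ v = some t

/-- `f_i(x) = x'` in `ρ`: all bits of `f_i(x)` are set, to the bits of `x'`. -/
def FVal (ρ : Restriction a b c) (i : Fin (a - 1)) (x x' : Fin b) : Prop :=
  ∀ j, ρ (.f i x j) = some ((x' : ℕ).testBit j)

/-- `u(x) = y` in `ρ`. -/
def UVal (ρ : Restriction a b c) (x : Fin b) (y : Fin c) : Prop :=
  ∀ j, ρ (.u x j) = some ((y : ℕ).testBit j)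

/-! ### Paths -/

/-- There is an edge from `v = (i, x)` to `w = (i + 1, x')` if `f_i(x) = x'` in `ρ`. -/
def Edge (ρ : Restriction a b c) (v w : Node a b) : Prop :=
  ∃ i : Fin (a - 1), (v.1 : ℕ) = i ∧ (w.1 : ℕ) = i + 1 ∧ FVal ρ i v.2 w.2

/-- A node without incoming edge. When all the `f_i` are partial injections, these are exactly the
first nodes of the paths, and every path is determined by its first node. -/
def IsStart (ρ : Restriction a b c) (s : Node a b) : Prop := ∀ v, ¬ Edge ρ v s

/-- The nodes reached from `s` by following the edges as far as possible. If `s` is a start node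
and all the `f_i` are partial injections, this is the path (the maximal sequence of nodes, each
being mapped to the next one) that begins at `s`. -/
def path (ρ : Restriction a b c) (s : Node a b) : Set (Node a b) :=
  {v | Relation.ReflTransGen (Edge ρ) s v}

/-- The node `(0, 0)`. -/
def origin [NeZero a] [NeZero b] : Node a b := (0, 0)

/-- The node lies on the bottom level `a - 1`. -/
def IsBottom (v : Node a b) : Prop := (v.1 : ℕ) + 1 = a

/-- No colour variable is set on the path beginning at `s` (including `u(x)` if the path contains
the bottom node `(a - 1, x)`). -/
def PathUncoloured (ρ : Restriction a b c) (s : Node a b) : Prop :=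
  ∀ v ∈ path ρ s, (∀ y, ρ (.G v.1 v.2 y) = none) ∧ (IsBottom v → ∀ j, ρ (.u v.2 j) = none)

/-- The path beginning at `s` has exactly the colour `y` (and `u(x) = y` if the path contains the
bottom node `(a - 1, x)`). -/
def PathColoured (ρ : Restriction a b c) (s : Node a b) (y : Fin c) : Prop :=
  ∀ v ∈ path ρ s, (∀ y', ρ (.G v.1 v.2 y') = some (decide (y' = y))) ∧
    (IsBottom v → UVal ρ v.2 y)

/-- On the path beginning at `s` all colour variables are set to `0`, that is, no node on the path
has a colour. -/
def PathBlank (ρ : Restriction a b c) (s : Node a b) : Prop :=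
  ∀ v ∈ path ρ s, ∀ y, ρ (.G v.1 v.2 y) = some false

/-! ### Legal and good restrictions -/

/-- Legal restrictions: the `f_i` are partial injections (each value is completely set or completely
unset); each path either has no colour variables set, or is coloured with one colour (and does not
begin at `(0, 0)`), or begins at `(0, 0)` and has no colours; and the path beginning at `(0, 0)`
does not reach the bottom level. -/
structure Legal [NeZero a] [NeZero b] (ρ : Restriction a b c) : Prop where
  total_or_unset : ∀ i x, (∃ x', FVal ρ i x x') ∨ ∀ j, ρ (.f i x j) = none
  injective : ∀ i x₁ x₂ x', FVal ρ i x₁ x' → FVal ρ i x₂ x' → x₁ = x₂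
  colours : ∀ s, IsStart ρ s →
    PathUncoloured ρ s ∨ (s ≠ origin ∧ ∃ y, PathColoured ρ s y) ∨ (s = origin ∧ PathBlank ρ s)
  origin_path : ∀ v ∈ path ρ origin, ¬ IsBottom v

/-- Good restrictions for `a = b = n`, `p = n^(-4/7)`, `q = n^(-2/7)`: legal restrictions of typical
size. No path has more than `n^(5/7)` nodes; on every level `i < n - 1` the number of `x` with
`f_i(x)` unset is at least half and at most twice `p * n = n^(3/7)`; and on every level there are
at least `p * q * n / 2 = n^(1/7) / 2` nodes which begin an uncoloured path. -/
structure Good {n c : ℕ} [NeZero n] (ρ : Restriction n n c) : Prop where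
  legal : Legal ρ
  path_length : ∀ s, IsStart ρ s → ((path ρ s).ncard : ℝ) ≤ (n : ℝ) ^ (5 / 7 : ℝ)
  unset_lower : ∀ i : Fin (n - 1),
    (n : ℝ) ^ (3 / 7 : ℝ) / 2 ≤ ({x : Fin n | ∀ x', ¬ FVal ρ i x x'}.ncard : ℝ)
  unset_upper : ∀ i : Fin (n - 1),
    ({x : Fin n | ∀ x', ¬ FVal ρ i x x'}.ncard : ℝ) ≤ 2 * (n : ℝ) ^ (3 / 7 : ℝ)
  uncoloured : ∀ i : Fin n, (n : ℝ) ^ (1 / 7 : ℝ) / 2 ≤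
    ({x : Fin n | IsStart ρ (i, x) ∧ PathUncoloured ρ (i, x)}.ncard : ℝ)

/-! ### Fixing -/

/-- `ρ` falsifies `B`: in some clause of `B` every literal is set to `0` by `ρ`. -/
def Falsifies (ρ : Restriction a b c) (B : CNF a b c) : Prop :=
  ∃ C ∈ B, ∀ l ∈ C, ρ l.1 = some (!l.2)

/-- `ρ` fixes `B` to the truth value `e`: `B` is fixed to `0` if `ρ` falsifies `B`, and it is fixed
to `1` if no legal extension of `ρ` falsifies `B`. -/
def Fixes [NeZero a] [NeZero b] (ρ : Restriction a b c) (B : CNF a b c) : Bool → Prop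
  | false => Falsifies ρ B
  | true => ∀ σ, Extends σ ρ → Legal σ → ¬ Falsifies σ B

/-! ### The distribution of random restrictions -/

/-- The outcome is `true` with probability `r`. -/
noncomputable def coin (r : ℝ≥0) (hr : r ≤ 1) : PMF Bool :=
  PMF.ofFintype (fun t => cond t (r : ℝ≥0∞) ((1 - r : ℝ≥0) : ℝ≥0∞)) (by
    rw [Fintype.sum_bool, cond_true, cond_false, ← ENNReal.coe_add, add_tsub_cancel_of_le hr,
      ENNReal.coe_one])

open scoped Classical in
/-- Independent choices `g i`, where `g i` has the distribution `μ i`. -/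
noncomputable def indep {ι : Type} [Fintype ι] {β : ι → Type} [∀ i, Fintype (β i)]
    (μ : ∀ i, PMF (β i)) : PMF (∀ i, β i) :=
  PMF.ofFintype (fun g => ∏ i, μ i (g i)) (by
    rw [← Fintype.piFinset_univ, ← Finset.prod_univ_sum]
    refine Finset.prod_eq_one fun i _ => ?_
    rw [← (μ i).tsum_coe, tsum_fintype])

open scoped Classical in
/-- One level of step R1: every `x < b` is left out of the domain `Z` independently with
probability `p` (and hence included with probability `1 - p`), and then an injection from `Z` into
`b` is chosen uniformly at random. Here `Z = {x | out x = false}`. -/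
noncomputable def randomPartialInjection (b : ℕ) (p : ℝ≥0) (hp : p ≤ 1) :
    PMF (Fin b → Option (Fin b)) :=
  (indep fun _ : Fin b => coin p hp).bind fun out =>
    haveI : Nonempty ({x : Fin b // out x = false} ↪ Fin b) := ⟨Function.Embedding.subtype _⟩
    (PMF.uniformOfFintype ({x : Fin b // out x = false} ↪ Fin b)).map fun e x =>
      if h : out x = false then some (e ⟨x, h⟩) else none

/-- The restriction that sets the `f`-variables according to the partial functions `F i`, and no
other variable. -/
def fRestriction (c : ℕ) (F : Fin (a - 1) → Fin b → Option (Fin b)) : Restriction a b c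
  | .f i x j => (F i x).map fun x' => (x' : ℕ).testBit j
  | .G _ _ _ => none
  | .u _ _ => none

/-- The first nodes of the paths other than the path beginning at `(0, 0)`. -/
abbrev OtherStart [NeZero a] [NeZero b] (ρ : Restriction a b c) : Type :=
  {s : Node a b // IsStart ρ s ∧ s ≠ origin}

/-- Step R3 for a single path: with probability `1 - q` a uniformly random colour, and with
probability `q` no colouring. -/
noncomputable def randomColour (c : ℕ) [NeZero c] (q : ℝ≥0) (hq : q ≤ 1) :
    PMF (Option (Fin c)) :=
  (coin q hq).bind fun t =>
    cond t (PMF.pure none) ((PMF.uniformOfFintype (Fin c)).map some)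

open scoped Classical in
/-- The colour assigned at step R3 to the path on which the node `v` lies, if there is one. -/
noncomputable def nodeColour [NeZero a] [NeZero b] (ρ : Restriction a b c)
    (χ : OtherStart ρ → Option (Fin c)) (v : Node a b) : Option (Fin c) :=
  if h : ∃ s : OtherStart ρ, v ∈ path ρ s.1 then χ h.choose else none

open scoped Classical in
/-- Adds the colour variables to `ρ = fRestriction c F`: on the path beginning at `(0, 0)` all colour
variables are set to `0` (R2), every other path is coloured according to `χ` (R3), and `u(x)` is the
colour assigned to the path of the bottom node `(a - 1, x)`, if there is one (R4). -/
noncomputable def colourRestriction [NeZero a] [NeZero b] (ρ : Restriction a b c)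
    (χ : OtherStart ρ → Option (Fin c)) : Restriction a b c
  | .f i x j => ρ (.f i x j)
  | .G i x y =>
      if (i, x) ∈ path ρ origin then some false
      else (nodeColour ρ χ (i, x)).map fun y' => decide (y = y')
  | .u x j =>
      (nodeColour ρ χ (⟨a - 1, Nat.sub_lt (NeZero.pos a) one_pos⟩, x)).map
        fun y => (y : ℕ).testBit j

open scoped Classical in
/-- The distribution `R_{p,q}` of random restrictions. -/
noncomputable def randomRestriction (a b c : ℕ) [NeZero a] [NeZero b] [NeZero c]
    (p q : ℝ≥0) (hp : p ≤ 1) (hq : q ≤ 1) : PMF (Restriction a b c) :=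
  (indep fun _ : Fin (a - 1) => randomPartialInjection b p hp).bind fun F =>
    (indep fun _ : OtherStart (fRestriction c F) => randomColour c q hq).map fun χ =>
      colourRestriction (fRestriction c F) χ

theorem rpow_neg_le_one (n : ℕ) [NeZero n] (r : ℝ) (hr : 0 ≤ r) : (n : ℝ≥0) ^ (-r) ≤ 1 :=
  NNReal.rpow_le_one_of_one_le_of_nonpos
    (by exact_mod_cast NeZero.one_le) (by linarith)

/-- The distribution `R_{p,q}` for `a = b = n`, `p = n^(-4/7)` and `q = n^(-2/7)`. -/
noncomputable def R (n c : ℕ) [NeZero n] [NeZero c] : PMF (Restriction n n c) :=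
  randomRestriction n n c ((n : ℝ≥0) ^ (-(4 / 7 : ℝ))) ((n : ℝ≥0) ^ (-(2 / 7 : ℝ)))
    (rpow_neg_le_one n _ (by norm_num)) (rpow_neg_le_one n _ (by norm_num))

/-- The probability of an event when `ρ` is drawn from `R n c`. -/
noncomputable def prob {n c : ℕ} [NeZero n] [NeZero c] (E : Set (Restriction n n c)) : ℝ :=
  ((R n c).toOuterMeasure E).toReal

/-- `ε`, the probability that a random restriction is bad. -/
noncomputable def badProb (n c : ℕ) [NeZero n] [NeZero c] : ℝ :=
  prob {ρ : Restriction n n c | ¬ Good ρ}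

/-! ### Decision trees -/

/-- Complete binary trees of height `h` whose internal nodes are labelled by elements of `α` and have
a NO child and a YES child. -/
inductive DecisionTree (α : Type) : ℕ → Type
  | leaf : DecisionTree α 0
  | node {h : ℕ} (B : α) (no yes : DecisionTree α h) : DecisionTree α (h + 1)

/-- A node at depth `d` is given by the sequence of the `d` answers leading to it from the root
(`false` is NO and `true` is YES). This is the list of the labels on the path from the root down to
the node `z`, without the label of `z` itself, each with the answer given by the outgoing edge. -/
def DecisionTree.queries {α : Type} : {h : ℕ} → DecisionTree α h → List Bool → List (α × Bool)
  | _, .leaf, _ => []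
  | _, .node _ _ _, [] => []
  | _, .node B no _, false :: z => (B, false) :: no.queries z
  | _, .node B _ yes, true :: z => (B, true) :: yes.queries z

variable {n k h : ℕ}

/-- The node `z` and the restriction `ρ` are compatible. -/
def Compatible [NeZero n] (T : DecisionTree (KCNF n n c k) h) (z : List Bool)
    (ρ : Restriction n n c) : Prop :=
  Good ρ ∧ ∀ Q ∈ T.queries z, Fixes ρ Q.1.1 Q.2

/-- The node `z` is big. -/
def Big [NeZero n] [NeZero c] (T : DecisionTree (KCNF n n c k) h) (z : List Bool) : Prop :=
  badProb n c < prob {ρ : Restriction n n c | Compatible T z ρ}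

/-- The set `S_d` of good restrictions compatible with some big node at depth `d`. -/
def bigSet [NeZero n] [NeZero c] (T : DecisionTree (KCNF n n c k) h) (d : ℕ) :
    Set (Restriction n n c) :=
  {ρ | Good ρ ∧ ∃ z : List Bool, z.length = d ∧ Big T z ∧ Compatible T z ρ}

end CPLS

namespace CPLS

/-! ### Path data: a combinatorial model of the legal restrictions that matter. -/

section

variable {a b c : ℕ}

/-! The heart is a switching-type estimate for one k-CNF `B` and one property `P` inherited by legal
extensions (`prob_not_fixes_le`): the event that ρ is good, satisfies `P` and does not fix `B` has
probability at most 6k n^(-1/7) (Pr[good and `P`] + ε). If ρ does not fix `B`, take the first clause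
that some legal extension of ρ falsifies, and extend ρ to a legal σ falsifying it by at most one
elementary step per literal (`Valid.exists_reach_falsifying`). No earlier clause is falsified by σ,
since σ is itself a legal extension of ρ. So σ alone reveals the clause, hence the list of variables
along which the steps were made (`Valid.exists_reach_of_not_fixes`).

The steps can be undone, and each makes a restriction much more likely. Colouring a path multiplies
the probability by (1-q)/(qc). Setting a value of `f_i`, of which at most m = 2n^(3/7) are unset,
multiplies it by at least (1-p)/(pm), possibly after colouring one of the two paths that are joined.
Given the variable and the result of a colouring or a joining, its source is unique. Hence the total
weight of all ρ from which a given σ is reached through k variables is at most (1+w)^k times the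
weight of σ, where w = 3n^(-1/7). As ρ differs from σ, the trivial chain may be subtracted, leaving
(1+w)^k - 1 ≤ 6k n^(-1/7) (`sum_reach_ne_le`, `one_add_pow_sub_one_le`). The term ε appears because
σ satisfies `P` but need not be good.

To compute with weights, legal restrictions whose path from (0,0) is blank are encoded by `Valid`
path data, with explicit probability `weight` (`Valid.randomRestriction_toReal`). Every restriction
of positive probability has that path blank (`randomRestriction_origin`).

In the tree, `P` is compatibility with a big node `z`; bigness absorbs ε into a factor 2. A legal
restriction agrees with at most one node of each depth, so the losses at all big nodes of depth d
sum to at most 12k n^(-1/7). Passing to children that are not big costs at most 2^(d+1) ε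
(`prob_bigSet_le_succ`). Induction on d finishes. -/

/-- A legal restriction in combinatorial form: the partial functions `f_i`, and for every node the
state of its path, which is `none` if the path is uncoloured, `some none` if all its colour variables
are `0`, and `some (some y)` if it has the colour `y`. -/
abbrev PathData (a b c : ℕ) : Type :=
  (Fin (a - 1) → Fin b → Option (Fin b)) × (Node a b → Option (Option (Fin c)))

/-- There is an edge from `v` to `w` in the graph of the partial functions `F i`. -/
def Arrow (F : Fin (a - 1) → Fin b → Option (Fin b)) (v w : Node a b) : Prop :=
  ∃ i : Fin (a - 1), (v.1 : ℕ) = i ∧ (w.1 : ℕ) = i + 1 ∧ F i v.2 = some w.2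

/-- The node `s` has no incoming edge. -/
def NoArrow (F : Fin (a - 1) → Fin b → Option (Fin b)) (s : Node a b) : Prop :=
  ∀ v, ¬ Arrow F v s

/-- The nodes `v` and `w` lie on the same path. -/
def Conn (F : Fin (a - 1) → Fin b → Option (Fin b)) : Node a b → Node a b → Prop :=
  Relation.EqvGen (Arrow F)

/-- The last level. -/
def bottomLevel [NeZero a] : Fin a := ⟨a - 1, Nat.sub_lt (NeZero.pos a) one_pos⟩

/-- The restriction described by path data. -/
def encode [NeZero a] (D : PathData a b c) : Restriction a b c
  | .f i x j => (D.1 i x).map fun x' => (x' : ℕ).testBit j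
  | .G i x y => (D.2 (i, x)).map fun o => decide (o = some y)
  | .u x j => (D.2 (bottomLevel, x)).bind fun o => o.map fun y => (y : ℕ).testBit j

/-- The path data of a legal restriction in which the path of `(0, 0)` is blank. -/
structure Valid [NeZero a] [NeZero b] (D : PathData a b c) : Prop where
  inj : ∀ i x₁ x₂ x', D.1 i x₁ = some x' → D.1 i x₂ = some x' → x₁ = x₂
  const : ∀ v w, Arrow D.1 v w → D.2 v = D.2 w
  origin : D.2 origin = some none
  start : ∀ s, NoArrow D.1 s → D.2 s = some none → s = CPLS.origin
  bottom : ∀ v, D.2 v = some none → ¬ IsBottom v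

/-! ### Paths of partial injections -/

theorem exists_noArrow (F : Fin (a - 1) → Fin b → Option (Fin b)) (v : Node a b) :
    ∃ s, NoArrow F s ∧ Relation.ReflTransGen (Arrow F) s v := by
  obtain ⟨m, hm⟩ : ∃ m : ℕ, (v.1 : ℕ) = m := ⟨_, rfl⟩
  induction m generalizing v with
  | zero =>
    refine ⟨v, ?_, .refl⟩
    rintro w ⟨i, -, h, -⟩
    omega
  | succ m ih =>
    by_cases hv : NoArrow F v
    · exact ⟨v, hv, .refl⟩
    · simp only [NoArrow, not_forall, not_not] at hv
      obtain ⟨w, hw⟩ := hv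
      obtain ⟨s, hs, hsw⟩ := ih w (by obtain ⟨i, h1, h2, -⟩ := hw; omega)
      exact ⟨s, hs, hsw.tail hw⟩

theorem NoArrow.eq_of_reflTransGen {F : Fin (a - 1) → Fin b → Option (Fin b)} {s t : Node a b}
    (hs : NoArrow F s) (h : Relation.ReflTransGen (Arrow F) t s) : t = s := by
  rcases Relation.ReflTransGen.cases_tail h with h | ⟨v, -, h⟩
  · exact h.symm
  · exact absurd h (hs v)

theorem Arrow.left_unique {F : Fin (a - 1) → Fin b → Option (Fin b)}
    (hF : ∀ i x₁ x₂ x', F i x₁ = some x' → F i x₂ = some x' → x₁ = x₂) {v₁ v₂ w : Node a b}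
    (h₁ : Arrow F v₁ w) (h₂ : Arrow F v₂ w) : v₁ = v₂ := by
  obtain ⟨i, h1, h2, h3⟩ := h₁
  obtain ⟨j, h4, h5, h6⟩ := h₂
  obtain rfl : i = j := Fin.ext (by omega)
  exact Prod.ext (Fin.ext (by omega)) (hF i _ _ _ h3 h6)

/-- Injectivity makes predecessors unique, so the ancestors of a node form a chain. When two
connections are composed, the ancestors found for each of them are comparable at the middle node,
and the earlier one serves. -/
theorem Conn.exists_common {F : Fin (a - 1) → Fin b → Option (Fin b)}
    (hF : ∀ i x₁ x₂ x', F i x₁ = some x' → F i x₂ = some x' → x₁ = x₂) {v w : Node a b}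
    (h : Conn F v w) : ∃ r, Relation.ReflTransGen (Arrow F) r v ∧
      Relation.ReflTransGen (Arrow F) r w := by
  induction h with
  | rel v w h => exact ⟨v, .refl, .single h⟩
  | refl v => exact ⟨v, .refl, .refl⟩
  | symm v w _ ih => obtain ⟨r, h1, h2⟩ := ih; exact ⟨r, h2, h1⟩
  | trans v w x _ _ ih1 ih2 =>
    obtain ⟨r, h1, h2⟩ := ih1
    obtain ⟨t, h3, h4⟩ := ih2
    have hU : Relator.RightUnique (Function.swap (Arrow F)) :=
      fun _ _ _ h h' => Arrow.left_unique hF h h'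
    rcases Relation.ReflTransGen.total_of_right_unique hU
      (Relation.reflTransGen_swap.2 h2) (Relation.reflTransGen_swap.2 h3) with h | h
    · exact ⟨t, (Relation.reflTransGen_swap.1 h).trans h1, h4⟩
    · exact ⟨r, h1, (Relation.reflTransGen_swap.1 h).trans h4⟩

/-- Together with `exists_noArrow` this gives exactly one start per path, so a product over starts
counts every path once. -/
theorem NoArrow.eq_of_conn {F : Fin (a - 1) → Fin b → Option (Fin b)}
    (hF : ∀ i x₁ x₂ x', F i x₁ = some x' → F i x₂ = some x' → x₁ = x₂) {s t : Node a b}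
    (hs : NoArrow F s) (ht : NoArrow F t) (h : Conn F s t) : s = t := by
  obtain ⟨r, h1, h2⟩ := h.exists_common hF
  rw [← hs.eq_of_reflTransGen h1, ← ht.eq_of_reflTransGen h2]

theorem conn_of_reflTransGen {F : Fin (a - 1) → Fin b → Option (Fin b)} {v w : Node a b}
    (h : Relation.ReflTransGen (Arrow F) v w) : Conn F v w := by
  induction h with
  | refl => exact .refl _
  | tail _ h ih => exact .trans _ _ _ ih (.rel _ _ h)

theorem Conn.eq_of_const {F : Fin (a - 1) → Fin b → Option (Fin b)} {γ : Type*}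
    {col : Node a b → γ} (hcol : ∀ v w, Arrow F v w → col v = col w) {v w : Node a b}
    (h : Conn F v w) : col v = col w := by
  induction h with
  | rel v w h => exact hcol v w h
  | refl v => rfl
  | symm v w _ ih => exact ih.symm
  | trans v w x _ _ ih1 ih2 => exact ih1.trans ih2

theorem Conn.congr_arrow {F : Fin (a - 1) → Fin b → Option (Fin b)} {r v w : Node a b}
    (h : Arrow F v w) : Conn F r v ↔ Conn F r w :=
  ⟨fun h' => .trans _ _ _ h' (.rel _ _ h), fun h' => .trans _ _ _ h' (.symm _ _ (.rel _ _ h))⟩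

theorem Conn.mono {F F' : Fin (a - 1) → Fin b → Option (Fin b)}
    (h : ∀ i x x', F i x = some x' → F' i x = some x') {v w : Node a b} (hvw : Conn F v w) :
    Conn F' v w :=
  Relation.EqvGen.mono (show Arrow F ≤ Arrow F' from
    fun _ _ ⟨i, h1, h2, h3⟩ => ⟨i, h1, h2, h _ _ _ h3⟩) _ _ hvw

/-! ### Restrictions described by path data -/

/-- The condition `0 < β` matters: for `b = 1` there are no bits, and `FVal` would hold vacuously
even where `F` is unset. -/
theorem fVal_iff {ρ : Restriction a b c} {F : Fin (a - 1) → Fin b → Option (Fin b)}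
    (hb : ∃ β, 0 < β ∧ b = 2 ^ β)
    (hρ : ∀ i x j, ρ (.f i x j) = (F i x).map fun x' => (x' : ℕ).testBit j) (i : Fin (a - 1))
    (x x' : Fin b) : FVal ρ i x x' ↔ F i x = some x' := by
  obtain ⟨β, hβ, hb⟩ := hb
  have hlog : Nat.log 2 b = β := by rw [hb, Nat.log_pow (by norm_num)]
  constructor
  · intro h
    rcases hF : F i x with _ | x''
    · have := h ⟨0, by omega⟩
      simp [hρ, hF] at this
    · congr 1
      refine Fin.ext (Nat.eq_of_testBit_eq fun j => ?_)
      by_cases hj : j < β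
      · have := h ⟨j, by omega⟩
        simpa [hρ, hF] using this
      · have hlt : 2 ^ β ≤ 2 ^ j := Nat.pow_le_pow_right (by norm_num) (by omega)
        rw [Nat.testBit_lt_two_pow (by omega), Nat.testBit_lt_two_pow (by omega)]
  · intro h j
    simp [hρ, h]

theorem edge_eq {ρ : Restriction a b c} {F : Fin (a - 1) → Fin b → Option (Fin b)}
    (hb : ∃ β, 0 < β ∧ b = 2 ^ β)
    (hρ : ∀ i x j, ρ (.f i x j) = (F i x).map fun x' => (x' : ℕ).testBit j) :
    Edge ρ = Arrow F := by
  ext v w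
  simp only [Edge, Arrow, fVal_iff hb hρ]

theorem edge_encode [NeZero a] (hb : ∃ β, 0 < β ∧ b = 2 ^ β) (D : PathData a b c) :
    Edge (encode D) = Arrow D.1 :=
  edge_eq hb fun _ _ _ => rfl

theorem Valid.path_eq [NeZero a] [NeZero b] (hb : ∃ β, 0 < β ∧ b = 2 ^ β) {D : PathData a b c}
    (hD : Valid D) {s v : Node a b} (h : v ∈ path (encode D) s) : D.2 v = D.2 s := by
  simp only [path, edge_encode hb, Set.mem_ofPred_eq] at h
  exact ((conn_of_reflTransGen h).eq_of_const hD.const).symm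

theorem IsBottom.fst_eq [NeZero a] {v : Node a b} (h : IsBottom v) : v.1 = bottomLevel :=
  Fin.ext (by simp only [IsBottom] at h; simp only [bottomLevel]; omega)

theorem Valid.legal [NeZero a] [NeZero b] (hb : ∃ β, 0 < β ∧ b = 2 ^ β) {D : PathData a b c}
    (hD : Valid D) : Legal (encode D) where
  total_or_unset i x := by
    rcases h : D.1 i x with _ | x'
    · exact .inr fun j => by simp [encode, h]
    · exact .inl ⟨x', fun j => by simp [encode, h]⟩
  injective i x₁ x₂ x' h₁ h₂ := by
    rw [fVal_iff hb (F := D.1) fun _ _ _ => rfl] at h₁ h₂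
    exact hD.inj _ _ _ _ h₁ h₂
  colours s hs := by
    have hu : ∀ v : Node a b, IsBottom v → ∀ j, encode D (.u v.2 j) =
        (D.2 v).bind fun o => o.map fun y => (y : ℕ).testBit j := by
      intro v hv j
      simp only [encode, ← hv.fst_eq]
    rcases h : D.2 s with _ | _ | y
    · refine .inl fun v hv => ⟨fun y => ?_, fun hb' j => ?_⟩
      · simp [encode, hD.path_eq hb hv, h]
      · simp [hu v hb', hD.path_eq hb hv, h]
    · refine .inr (.inr ⟨hD.start s ?_ h, fun v hv y => ?_⟩)
      · simpa only [IsStart, NoArrow, edge_encode hb] using hs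
      · simp [encode, hD.path_eq hb hv, h]
    · refine .inr (.inl ⟨?_, y, fun v hv => ⟨fun y' => ?_, fun hb' j => ?_⟩⟩)
      · rintro rfl
        simp [hD.origin] at h
      · simp [encode, hD.path_eq hb hv, h, eq_comm]
      · simp [hu v hb', hD.path_eq hb hv, h]
  origin_path v hv := hD.bottom v (by rw [hD.path_eq hb hv, hD.origin])

theorem map_decide_injective [NeZero c] {o o' : Option (Option (Fin c))}
    (h : ∀ y, o.map (fun t => decide (t = some y)) = o'.map fun t => decide (t = some y)) :
    o = o' := by
  rcases o with _ | _ | y <;> rcases o' with _ | _ | y'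
  · rfl
  · simpa using h 0
  · simpa using h 0
  · simpa using h 0
  · rfl
  · simpa using h y'
  · simpa using h 0
  · simpa using h y
  · simpa using (h y').symm

/-- Legality also permits the path of (0,0) to have no colour variable set. The condition `h0`
excludes this; it holds on the support of the distribution and passes to extensions. -/
theorem Legal.exists_valid [NeZero a] [NeZero b] [NeZero c] {ρ : Restriction a b c} (hρ : Legal ρ)
    (h0 : ρ (.G 0 0 0) = some false) (hb : ∃ β, 0 < β ∧ b = 2 ^ β) :
    ∃ D : PathData a b c, Valid D ∧ encode D = ρ := by
  classical
  have hF : ∀ i x, ∃ o : Option (Fin b), ∀ j, ρ (.f i x j) = o.map fun x' => (x' : ℕ).testBit j := by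
    intro i x
    rcases hρ.total_or_unset i x with ⟨x', h⟩ | h
    · exact ⟨some x', h⟩
    · exact ⟨none, h⟩
  choose F hF using hF
  have hE : Edge ρ = Arrow F := edge_eq hb hF
  have key : ∀ s, NoArrow F s → ∃ o : Option (Option (Fin c)), (o = some none → s = origin) ∧
      ∀ v, Relation.ReflTransGen (Arrow F) s v →
      (∀ y, ρ (.G v.1 v.2 y) = o.map fun t => decide (t = some y)) ∧ (IsBottom v → ∀ j,
        ρ (.u v.2 j) = o.bind fun t => t.map fun y => (y : ℕ).testBit j) := by
    intro s hs
    have hp : ∀ v, Relation.ReflTransGen (Arrow F) s v → v ∈ path ρ s := fun v hv => by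
      simpa only [path, hE, Set.mem_ofPred_eq] using hv
    rcases hρ.colours s (by simpa only [IsStart, NoArrow, hE] using hs) with h | ⟨h, y, h'⟩ | ⟨h, h'⟩
    · exact ⟨none, by simp, fun v hv => by simpa using h v (hp v hv)⟩
    · refine ⟨some (some y), by simp, fun v hv => ?_⟩
      have := h' v (hp v hv)
      refine ⟨fun y' => by simp [this.1 y', eq_comm], fun hb' j => ?_⟩
      simpa using this.2 hb' j
    · refine ⟨some none, fun _ => h, fun v hv => ⟨fun y => by simp [h' v (hp v hv)], fun hb' => ?_⟩⟩
      -- A blank path begins at (0,0) and so misses the last level; the requirement on `u` is empty.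
      subst h
      exact absurd hb' (hρ.origin_path v (hp v hv))
  choose st hst hrt using exists_noArrow F
  choose! o ho1 ho2 using key
  have hcol : ∀ v, (∀ y, ρ (.G v.1 v.2 y) = (o (st v)).map fun t => decide (t = some y)) ∧
      (IsBottom v → ∀ j, ρ (.u v.2 j) =
        (o (st v)).bind fun t => t.map fun y => (y : ℕ).testBit j) :=
    fun v => ho2 _ (hst v) v (hrt v)
  have horig : ∀ v, o (st v) = some none → st v = origin := fun v h => ho1 _ (hst v) h
  have hstart : ∀ s, NoArrow F s → st s = s := fun s hs => hs.eq_of_reflTransGen (hrt s)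
  have hD : encode (F, fun v => o (st v)) = ρ := by
    funext v
    cases v with
    | f i x j => exact (hF i x j).symm
    | G i x y => exact ((hcol (i, x)).1 y).symm
    | u x j =>
      exact ((hcol (bottomLevel, x)).2
        (by have := NeZero.pos a; simp only [IsBottom, bottomLevel]; omega) j).symm
  refine ⟨_, ⟨?_, ?_, ?_, ?_, ?_⟩, hD⟩
  · intro i x₁ x₂ x' h₁ h₂
    exact hρ.injective i x₁ x₂ x' ((fVal_iff hb hF _ _ _).2 h₁) ((fVal_iff hb hF _ _ _).2 h₂)
  · intro v w hvw
    refine map_decide_injective fun y => ?_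
    rw [← (hcol w).1 y]
    exact ((ho2 _ (hst v) w ((hrt v).tail hvw)).1 y).symm
  · have hs : st (origin : Node a b) = origin := by
      refine hstart _ ?_
      rintro v ⟨i, -, h, -⟩
      simp [origin] at h
    have h1 : o origin ≠ none := fun h => by
      have := (hcol origin).1 0
      rw [hs, h] at this
      simp [origin, h0] at this
    rcases hρ.colours origin (by
      simp only [IsStart, hE]
      rintro v ⟨i, -, h, -⟩
      simp [origin] at h) with h | ⟨h, -⟩ | ⟨-, h⟩
    · have := (h origin Relation.ReflTransGen.refl).1 0
      simp [origin, h0] at this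
    · exact absurd rfl h
    · refine map_decide_injective fun y => ?_
      rw [← (hcol origin).1 y]
      simpa using h origin Relation.ReflTransGen.refl y
  · intro s hs h
    rw [← hstart s hs]
    exact horig s h
  · intro v h
    refine hρ.origin_path v ?_
    simp only [path, hE, Set.mem_ofPred_eq]
    rw [← horig v h]
    exact hrt v

/-- The order on path data that corresponds to extension of restrictions. -/
def PathData.Le (D S : PathData a b c) : Prop :=
  (∀ i x x', D.1 i x = some x' → S.1 i x = some x') ∧ ∀ v o, D.2 v = some o → S.2 v = some o

theorem PathData.Le.extends [NeZero a] {D S : PathData a b c} (h : D.Le S) :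
    Extends (encode S) (encode D) := by
  rintro (⟨i, x, j⟩ | ⟨i, x, y⟩ | ⟨x, j⟩) t ht
  · simp only [encode] at ht ⊢
    rcases hx : D.1 i x with _ | x'
    · simp [hx] at ht
    · rwa [h.1 _ _ _ hx, ← hx]
  · simp only [encode, Option.map_eq_some_iff] at ht ⊢
    obtain ⟨x', h1, h2⟩ := ht
    exact ⟨x', h.2 _ _ h1, h2⟩
  · simp only [encode, Option.bind_eq_some_iff] at ht ⊢
    obtain ⟨x', h1, h2⟩ := ht
    exact ⟨x', h.2 _ _ h1, h2⟩

theorem Extends.le [NeZero a] [NeZero c] (hb : ∃ β, 0 < β ∧ b = 2 ^ β) {D S : PathData a b c}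
    (h : Extends (encode S) (encode D)) : D.Le S := by
  constructor
  · intro i x x' hx
    rw [← fVal_iff hb (ρ := encode S) (F := S.1) fun _ _ _ => rfl]
    rw [← fVal_iff hb (ρ := encode D) (F := D.1) fun _ _ _ => rfl] at hx
    exact fun j => h _ _ (hx j)
  · intro v o ho
    rw [← ho]
    refine map_decide_injective fun y => ?_
    have := h (.G v.1 v.2 y) (decide (o = some y)) (by simp [encode, ho])
    simpa [encode, ho] using this

/-- Extension of encodings is the order on path data, and that order is antisymmetric. -/
theorem encode_injective [NeZero a] [NeZero c] (hb : ∃ β, 0 < β ∧ b = 2 ^ β) :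
    Function.Injective (encode : PathData a b c → Restriction a b c) := by
  intro D S h
  have h1 : D.Le S := Extends.le hb (by rw [h]; exact fun _ _ h => h)
  have h2 : S.Le D := Extends.le hb (by rw [h]; exact fun _ _ h => h)
  refine Prod.ext (funext fun i => funext fun x => Option.ext fun x' => ?_)
    (funext fun v => Option.ext fun o => ?_)
  · exact ⟨h1.1 _ _ _, h2.1 _ _ _⟩
  · exact ⟨h1.2 _ _, h2.2 _ _⟩

/-! ### Weights of path data -/

/-- The number of arguments at which a partial function is unset. -/
def unsetCard (g : Fin b → Option (Fin b)) : ℕ := (Finset.univ.filter fun x => g x = none).card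

/-- The number of arguments at which a partial function is set. -/
def setCard (g : Fin b → Option (Fin b)) : ℕ := (Finset.univ.filter fun x => g x ≠ none).card

/-- The probability of a given partial injection on one level. -/
noncomputable def levelWeight (p : ℝ) (g : Fin b → Option (Fin b)) : ℝ :=
  p ^ unsetCard g * (1 - p) ^ setCard g / b.descFactorial (setCard g)

/-- The probability of a given state of a path other than the path of `(0, 0)`. -/
noncomputable def colourWeight (q : ℝ) : Option (Option (Fin c)) → ℝ
  | none => q
  | some _ => (1 - q) / c

open scoped Classical in
/-- The probability of given states of the paths. -/
noncomputable def colourProd [NeZero a] [NeZero b] (q : ℝ) (D : PathData a b c) : ℝ :=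
  ∏ v, if NoArrow D.1 v ∧ v ≠ origin then colourWeight q (D.2 v) else 1

/-- The probability of given path data. -/
noncomputable def weight [NeZero a] [NeZero b] (p q : ℝ) (D : PathData a b c) : ℝ :=
  (∏ i, levelWeight p (D.1 i)) * colourProd q D

theorem unsetCard_add_setCard (g : Fin b → Option (Fin b)) : unsetCard g + setCard g = b := by
  simp only [unsetCard, setCard]
  rw [Finset.card_filter_add_card_filter_not]
  simp

theorem levelWeight_nonneg {p : ℝ} (h0 : 0 ≤ p) (h1 : p ≤ 1) (g : Fin b → Option (Fin b)) :
    0 ≤ levelWeight p g := by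
  have : 0 ≤ 1 - p := by linarith
  unfold levelWeight
  positivity

theorem colourWeight_nonneg {q : ℝ} (h0 : 0 ≤ q) (h1 : q ≤ 1) (o : Option (Option (Fin c))) :
    0 ≤ colourWeight q o := by
  have : 0 ≤ 1 - q := by linarith
  rcases o with _ | o
  · exact h0
  · simp only [colourWeight]; positivity

theorem colourWeight_le_one [NeZero c] {q : ℝ} (h0 : 0 ≤ q) (h1 : q ≤ 1)
    (o : Option (Option (Fin c))) : colourWeight q o ≤ 1 := by
  have hc : (1 : ℝ) ≤ c := by exact_mod_cast NeZero.one_le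
  rcases o with _ | o
  · exact h1
  · simp only [colourWeight]
    rw [div_le_one (by linarith)]
    linarith

theorem colourProd_nonneg [NeZero a] [NeZero b] {q : ℝ} (h0 : 0 ≤ q) (h1 : q ≤ 1)
    (D : PathData a b c) : 0 ≤ colourProd q D := by
  refine Finset.prod_nonneg fun v _ => ?_
  split_ifs
  · exact colourWeight_nonneg h0 h1 _
  · exact zero_le_one

theorem weight_nonneg [NeZero a] [NeZero b] {p q : ℝ} (hp0 : 0 ≤ p) (hp1 : p ≤ 1) (hq0 : 0 ≤ q)
    (hq1 : q ≤ 1) (D : PathData a b c) : 0 ≤ weight p q D :=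
  mul_nonneg (Finset.prod_nonneg fun _ _ => levelWeight_nonneg hp0 hp1 _)
    (colourProd_nonneg hq0 hq1 D)

theorem unsetCard_update {g : Fin b → Option (Fin b)} {x : Fin b} (hx : g x = none) (x' : Fin b) :
    unsetCard g = unsetCard (Function.update g x (some x')) + 1 := by
  simp only [unsetCard]
  have : (Finset.univ.filter fun z => g z = none) =
      insert x (Finset.univ.filter fun z => Function.update g x (some x') z = none) := by
    ext z
    by_cases hz : z = x
    · subst hz; simp [hx]
    · simp [hz]
  rw [this, Finset.card_insert_of_notMem (by simp)]

/-- One factor `p` is exchanged for `1 - p`, and the falling factorial acquires the factor `b -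
setCard g`, which is the number of unset arguments. -/
theorem levelWeight_update {p : ℝ} {g : Fin b → Option (Fin b)} {x : Fin b} (hx : g x = none)
    (x' : Fin b) : levelWeight p g * (1 - p) =
      p * unsetCard g * levelWeight p (Function.update g x (some x')) := by
  have h1 := unsetCard_update hx x'
  have h2 := unsetCard_add_setCard g
  have h3 := unsetCard_add_setCard (Function.update g x (some x'))
  have h4 : setCard (Function.update g x (some x')) = setCard g + 1 := by omega
  have h5 : b - setCard g = unsetCard g := by omega
  have h6 : b.descFactorial (setCard g) ≠ 0 := by
    rw [Ne, Nat.descFactorial_eq_zero_iff_lt]; omega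
  have h7 : (unsetCard g : ℝ) ≠ 0 := by
    rw [h1]; positivity
  have h6' : (b.descFactorial (setCard g) : ℝ) ≠ 0 := by exact_mod_cast h6
  unfold levelWeight
  rw [h4, Nat.descFactorial_succ, h5]
  push_cast
  field_simp
  rw [show p ^ unsetCard g = p * p ^ unsetCard (Function.update g x (some x')) by
    rw [h1, pow_succ']]
  ring

/-! ### Moves: elementary extensions of path data -/

open scoped Classical in
/-- Changes the state of the path of `v` to `o`. -/
noncomputable def recolour (D : PathData a b c) (v : Node a b) (o : Option (Option (Fin c))) :
    PathData a b c :=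
  (D.1, fun w => if Conn D.1 v w then o else D.2 w)

/-- The path of `v` receives a colour. -/
def ColourMove [NeZero a] [NeZero b] (v : Node a b) (D D' : PathData a b c) : Prop :=
  Valid D ∧ D.2 v = none ∧ ∃ y, D' = recolour D v (some (some y))

theorem recolour_recolour (D : PathData a b c) (v : Node a b) (o o' : Option (Option (Fin c))) :
    recolour (recolour D v o) v o' = recolour D v o' := by
  refine Prod.ext rfl (funext fun w => ?_)
  by_cases h : Conn D.1 v w <;> simp [recolour, h]

theorem Valid.recolour_self [NeZero a] [NeZero b] {D : PathData a b c} (hD : Valid D)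
    (v : Node a b) : recolour D v (D.2 v) = D := by
  refine Prod.ext rfl (funext fun w => ?_)
  simp only [recolour]
  split_ifs with h
  · exact h.eq_of_const hD.const
  · rfl

/-- The functions `f_i` are unchanged, so the path of `v` is known from `D'`; erasing its colour
restores the source. -/
theorem ColourMove.unique [NeZero a] [NeZero b] {v : Node a b} {D₁ D₂ D' : PathData a b c}
    (h₁ : ColourMove v D₁ D') (h₂ : ColourMove v D₂ D') : D₁ = D₂ := by
  obtain ⟨hv₁, hn₁, y₁, e₁⟩ := h₁
  obtain ⟨hv₂, hn₂, y₂, e₂⟩ := h₂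
  rw [← hv₁.recolour_self v, ← hv₂.recolour_self v, hn₁, hn₂,
    ← recolour_recolour D₁ v (some (some y₁)), ← recolour_recolour D₂ v (some (some y₂)),
    ← e₁, ← e₂]

/-- Only the factor at the start of the path of `v` changes, from `q` to `(1 - q) / c`. That start
is not (0,0), whose path is blank. -/
theorem ColourMove.weight_eq [NeZero a] [NeZero b] [NeZero c] {p q : ℝ} (hq : q < 1)
    {v : Node a b} {D D' : PathData a b c} (h : ColourMove v D D') :
    weight p q D = q * c / (1 - q) * weight p q D' := by
  classical
  obtain ⟨hD, hv, y, rfl⟩ := h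
  obtain ⟨s, hs, hsv⟩ := exists_noArrow D.1 v
  have hvs : Conn D.1 v s := .symm _ _ (conn_of_reflTransGen hsv)
  have hsn : D.2 s = none := by rw [← hvs.eq_of_const hD.const, hv]
  have hs0 : s ≠ origin := by
    rintro rfl
    simp [hD.origin] at hsn
  have hc : (c : ℝ) ≠ 0 := by exact_mod_cast NeZero.ne c
  have hq' : 1 - q ≠ 0 := by linarith
  suffices h : colourProd q D = q * c / (1 - q) * colourProd q (recolour D v (some (some y))) by
    unfold weight
    rw [h]
    simp only [recolour]
    ring
  -- Writing the ratio as a product concentrated at `s` permits a comparison factor by factor.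
  have h1 : q * c / (1 - q) = ∏ w, if w = s then q * c / (1 - q) else 1 := by
    rw [Finset.prod_ite_eq']; simp
  unfold colourProd
  rw [h1, ← Finset.prod_mul_distrib]
  refine Finset.prod_congr rfl fun w _ => ?_
  by_cases hw : w = s
  · subst hw
    rw [if_pos ⟨hs, hs0⟩, if_pos rfl, if_pos ⟨hs, hs0⟩, hsn]
    simp only [recolour, hvs, if_true, colourWeight]
    field_simp
  · rw [if_neg hw, one_mul]
    by_cases hwn : NoArrow D.1 w
    · have : ¬ Conn D.1 v w := fun h => hw (hwn.eq_of_conn hD.inj hs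
        (.trans _ _ _ (.symm _ _ h) hvs))
      simp only [recolour, this, if_false]
    · simp only [recolour, hwn, false_and, if_false]

/-- The node of level `i` from which `f_i(x)` leads. -/
def srcNode (i : Fin (a - 1)) (x : Fin b) : Node a b := (⟨i, by omega⟩, x)

/-- The node of level `i + 1` to which an edge from level `i` leads. -/
def tgtNode (i : Fin (a - 1)) (x' : Fin b) : Node a b := (⟨i + 1, by omega⟩, x')

/-- Sets `f_i(x)` to `x'`. -/
def addArrow (F : Fin (a - 1) → Fin b → Option (Fin b)) (i : Fin (a - 1)) (x x' : Fin b) :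
    Fin (a - 1) → Fin b → Option (Fin b) :=
  Function.update F i (Function.update (F i) x (some x'))

theorem addArrow_self (F : Fin (a - 1) → Fin b → Option (Fin b)) (i : Fin (a - 1)) (x x' : Fin b) :
    addArrow F i x x' i x = some x' := by
  simp [addArrow]

theorem addArrow_of_ne (F : Fin (a - 1) → Fin b → Option (Fin b)) {i j : Fin (a - 1)}
    {x z : Fin b} (x' : Fin b) (h : ¬ (j = i ∧ z = x)) : addArrow F i x x' j z = F j z := by
  by_cases hj : j = i
  · subst hj
    simp only [addArrow, Function.update_self]
    rw [Function.update_of_ne fun hz => h ⟨rfl, hz⟩]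
  · simp only [addArrow, Function.update_of_ne hj]

theorem arrow_addArrow {F : Fin (a - 1) → Fin b → Option (Fin b)} {i : Fin (a - 1)} {x : Fin b}
    (hx : F i x = none) (x' : Fin b) (v w : Node a b) :
    Arrow (addArrow F i x x') v w ↔ Arrow F v w ∨ (v = srcNode i x ∧ w = tgtNode i x') := by
  constructor
  · rintro ⟨j, h1, h2, h3⟩
    by_cases h : j = i ∧ v.2 = x
    · obtain ⟨rfl, rfl⟩ := h
      rw [addArrow_self] at h3
      exact .inr ⟨Prod.ext (Fin.ext h1) rfl, Prod.ext (Fin.ext h2) (Option.some.inj h3).symm⟩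
    · rw [addArrow_of_ne _ _ h] at h3
      exact .inl ⟨j, h1, h2, h3⟩
  · rintro (⟨j, h1, h2, h3⟩ | ⟨rfl, rfl⟩)
    · refine ⟨j, h1, h2, ?_⟩
      rw [addArrow_of_ne, h3]
      rintro ⟨rfl, h⟩
      simp [h, hx] at h3
    · exact ⟨i, rfl, rfl, addArrow_self _ _ _ _⟩

/-- `f_i(x)`, one of at most `m` unset values on level `i`, is set so that it joins two paths in the
same state, or the path of `(0, 0)` and an uncoloured path. -/
def MergeMove [NeZero a] [NeZero b] (m : ℝ) (i : Fin (a - 1)) (x : Fin b) (D D' : PathData a b c) :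
    Prop :=
  Valid D ∧ Valid D' ∧ D.1 i x = none ∧ (unsetCard (D.1 i) : ℝ) ≤ m ∧
    ∃ x', D'.1 = addArrow D.1 i x x' ∧
      ((D.2 (srcNode i x) ≠ some none ∧ D'.2 = D.2) ∨
        (D.2 (srcNode i x) = some none ∧ D.2 (tgtNode i x') = none ∧
          D'.2 = (recolour D (tgtNode i x') (some none)).2))

theorem Valid.not_arrow_tgt [NeZero a] [NeZero b] {D D' : PathData a b c} (hD' : Valid D')
    {i : Fin (a - 1)} {x x' : Fin b} (hx : D.1 i x = none) (h : D'.1 = addArrow D.1 i x x') :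
    NoArrow D.1 (tgtNode i x') := by
  intro v hv
  have h1 : Arrow D'.1 v (tgtNode i x') := by
    rw [h, arrow_addArrow hx]; exact .inl hv
  have h2 : Arrow D'.1 (srcNode i x) (tgtNode i x') := by
    rw [h, arrow_addArrow hx]; exact .inr ⟨rfl, rfl⟩
  have h3 := h1.left_unique hD'.inj h2
  obtain ⟨j, h4, h5, h6⟩ := hv
  rw [h3] at h4 h6
  obtain rfl : i = j := Fin.ext (by simpa [srcNode] using h4)
  simp [srcNode, hx] at h6

/-- The new target is the value of `f_i(x)` in `D'`, so the functions are recovered. The state of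
the source node in `D'` tells which kind of joining occurred: if it is blank, the path of the target
was uncoloured before; otherwise no state changed. -/
theorem MergeMove.unique [NeZero a] [NeZero b] {m : ℝ} {i : Fin (a - 1)} {x : Fin b}
    {D₁ D₂ D' : PathData a b c} (h₁ : MergeMove m i x D₁ D') (h₂ : MergeMove m i x D₂ D') :
    D₁ = D₂ := by
  obtain ⟨hv₁, hv', hn₁, -, x₁, e₁, h₁⟩ := h₁
  obtain ⟨hv₂, -, hn₂, -, x₂, e₂, h₂⟩ := h₂
  have hx : x₁ = x₂ := by
    have := addArrow_self D₁.1 i x x₁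
    rw [← e₁, e₂, addArrow_self] at this
    exact (Option.some.inj this).symm
  subst hx
  have hF : D₁.1 = D₂.1 := by
    funext j z
    by_cases h : j = i ∧ z = x
    · rw [h.1, h.2, hn₁, hn₂]
    · rw [← addArrow_of_ne D₁.1 x₁ h, ← addArrow_of_ne D₂.1 x₁ h, ← e₁, e₂]
  have hsrc : ∀ {D : PathData a b c}, D'.1 = addArrow D.1 i x x₁ → Valid D → D.1 i x = none →
      ((D.2 (srcNode i x) ≠ some none ∧ D'.2 = D.2) ∨
        (D.2 (srcNode i x) = some none ∧ D.2 (tgtNode i x₁) = none ∧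
          D'.2 = (recolour D (tgtNode i x₁) (some none)).2)) →
      D.2 = if D'.2 (srcNode i x) = some none then
        (recolour (D.1, D'.2) (tgtNode i x₁) none).2 else D'.2 := by
    intro D e hD hn h
    rcases h with ⟨h1, h2⟩ | ⟨h1, h2, h3⟩
    · rw [if_neg (by rwa [h2]), h2]
    · have h4 : D'.2 (srcNode i x) = some none := by
        rw [h3]; simp only [recolour]; split_ifs; exacts [rfl, h1]
      have h5 : (D.1, D'.2) = recolour D (tgtNode i x₁) (some none) := by rw [h3]; rfl
      rw [if_pos h4, h5, recolour_recolour, ← h2, hD.recolour_self]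
  refine Prod.ext hF ?_
  rw [hsrc e₁ hv₁ hn₁ h₁, hsrc e₂ hv₂ hn₂ h₂, hF]

/-- Level `i` contributes the ratio from `levelWeight_update`. The target node ceases to be a start,
so a colour factor of at most 1 disappears; all other starts keep their states. -/
theorem MergeMove.weight_le [NeZero a] [NeZero b] [NeZero c] {m p q : ℝ} (hp0 : 0 ≤ p) (hp1 : p < 1)
    (hq0 : 0 ≤ q) (hq1 : q ≤ 1) {i : Fin (a - 1)} {x : Fin b} {D D' : PathData a b c}
    (h : MergeMove m i x D D') : weight p q D ≤ p * m / (1 - p) * weight p q D' := by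
  classical
  obtain ⟨hD, hD', hx, hm, x', hF, hcol⟩ := h
  have hb := hD'.not_arrow_tgt hx hF
  have hne : ∀ v, v ≠ tgtNode i x' → (NoArrow D'.1 v ↔ NoArrow D.1 v) := by
    intro v hv
    simp only [NoArrow, hF, arrow_addArrow hx]
    simp [hv]
  have hnb : ¬ NoArrow D'.1 (tgtNode i x') := fun h => h (srcNode i x) (by
    rw [hF, arrow_addArrow hx]; exact .inr ⟨rfl, rfl⟩)
  have hc : colourProd q D ≤ colourProd q D' := by
    refine Finset.prod_le_prod (fun v _ => ?_) fun v _ => ?_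
    · split_ifs
      · exact colourWeight_nonneg hq0 hq1 _
      · exact zero_le_one
    · by_cases hv : v = tgtNode i x'
      · subst hv
        simp only [hnb, false_and, if_false]
        split_ifs
        · exact colourWeight_le_one hq0 hq1 _
        · exact le_rfl
      · rw [hne v hv]
        split_ifs with h
        · have : D'.2 v = D.2 v := by
            rcases hcol with ⟨-, h2⟩ | ⟨-, -, h2⟩
            · rw [h2]
            · rw [h2]
              have : ¬ Conn D.1 (tgtNode i x') v :=
                fun h' => hv (h.1.eq_of_conn hD.inj hb (.symm _ _ h'))
              simp only [recolour, this, if_false]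
          rw [this]
        · exact le_rfl
  have hl : ∏ j, levelWeight p (D.1 j) ≤ p * m / (1 - p) * ∏ j, levelWeight p (D'.1 j) := by
    rw [← Finset.mul_prod_erase _ _ (Finset.mem_univ i),
      ← Finset.mul_prod_erase _ (fun j => levelWeight p (D'.1 j)) (Finset.mem_univ i), ← mul_assoc]
    have h1 : ∏ j ∈ Finset.univ.erase i, levelWeight p (D.1 j) =
        ∏ j ∈ Finset.univ.erase i, levelWeight p (D'.1 j) := by
      refine Finset.prod_congr rfl fun j hj => ?_
      rw [hF, addArrow, Function.update_of_ne (Finset.ne_of_mem_erase hj)]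
    rw [h1]
    refine mul_le_mul_of_nonneg_right ?_
      (Finset.prod_nonneg fun _ _ => levelWeight_nonneg hp0 hp1.le _)
    have h2 := levelWeight_update (p := p) hx x'
    have h3 : D'.1 i = Function.update (D.1 i) x (some x') := by
      rw [hF, addArrow, Function.update_self]
    rw [← h3] at h2
    have h4 : 0 < 1 - p := by linarith
    have h5 := levelWeight_nonneg hp0 hp1.le (D'.1 i)
    rw [div_mul_eq_mul_div, le_div_iff₀ h4, h2]
    gcongr
  unfold weight
  rw [← mul_assoc]
  exact mul_le_mul hl hc (colourProd_nonneg hq0 hq1 _)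
    ((Finset.prod_nonneg fun _ _ => levelWeight_nonneg hp0 hp1.le _).trans hl)

/-! ### Bounding the weight of preimages -/

section BackSum

open scoped Classical in
/-- The total weight of the `x` related to `y`. -/
noncomputable def backSum {α : Type*} [Fintype α] (μ : α → ℝ) (r : α → α → Prop) (y : α) : ℝ :=
  ∑ x with r x y, μ x

variable {α : Type*} [Fintype α] {μ : α → ℝ} {r s : α → α → Prop} {A B : ℝ}

theorem backSum_eq_ite [DecidableRel r] (y : α) :
    backSum μ r y = ∑ x, if r x y then μ x else 0 := by
  rw [backSum, Finset.sum_filter]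
  exact Finset.sum_congr rfl fun x _ => by congr

theorem backSum_mono (hμ : ∀ x, 0 ≤ μ x) {y : α} (h : ∀ x, r x y → s x y) :
    backSum μ r y ≤ backSum μ s y := by
  classical
  refine Finset.sum_le_sum_of_subset_of_nonneg (fun x => ?_) fun x _ _ => hμ x
  simpa using h x

theorem backSum_or_le (hμ : ∀ x, 0 ≤ μ x) (y : α) :
    backSum μ (fun x y => r x y ∨ s x y) y ≤ backSum μ r y + backSum μ s y := by
  classical
  simp only [backSum_eq_ite, ← Finset.sum_add_distrib]
  refine Finset.sum_le_sum fun x _ => ?_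
  have := hμ x
  by_cases h1 : r x y <;> by_cases h2 : s x y <;> simp [h1, h2, this]

theorem backSum_eq (y : α) : backSum μ (fun x y => y = x) y = μ y := by
  classical
  simp [backSum_eq_ite]

theorem backSum_le_of_unique (hμ : ∀ x, 0 ≤ μ x) (hA : 0 ≤ A) {y : α}
    (h1 : ∀ x₁ x₂, r x₁ y → r x₂ y → x₁ = x₂) (h2 : ∀ x, r x y → μ x ≤ A * μ y) :
    backSum μ r y ≤ A * μ y := by
  classical
  by_cases h : ∃ x, r x y
  · obtain ⟨x, hx⟩ := h
    have : (Finset.univ.filter fun z => r z y) = {x} := by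
      ext z
      simpa using ⟨fun hz => h1 z x hz hx, fun hz => hz ▸ hx⟩
    rw [backSum, this, Finset.sum_singleton]
    exact h2 x hx
  · push Not at h
    have : (Finset.univ.filter fun z => r z y) = ∅ := by
      ext z
      simpa using h z
    rw [backSum, this, Finset.sum_empty]
    exact mul_nonneg hA (hμ y)

/-- Summing over the intermediate points `y` counts each source at least once, so backward bounds
multiply along a composition. -/
theorem backSum_comp_le (hμ : ∀ x, 0 ≤ μ x) (hA : 0 ≤ A) (h1 : ∀ y, backSum μ r y ≤ A * μ y) {z : α}
    (h2 : backSum μ s z ≤ B * μ z) :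
    backSum μ (fun x z => ∃ y, r x y ∧ s y z) z ≤ A * B * μ z := by
  classical
  calc backSum μ (fun x z => ∃ y, r x y ∧ s y z) z
      ≤ ∑ x, ∑ y, if r x y ∧ s y z then μ x else 0 := by
        rw [backSum_eq_ite]
        refine Finset.sum_le_sum fun x _ => ?_
        have h0 : ∀ y ∈ Finset.univ, 0 ≤ if r x y ∧ s y z then μ x else 0 := by
          intro y _
          split_ifs
          exacts [hμ x, le_rfl]
        split_ifs with h
        · obtain ⟨y, hy⟩ := h
          refine le_trans ?_ (Finset.single_le_sum h0 (Finset.mem_univ y))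
          rw [if_pos hy]
        · exact Finset.sum_nonneg h0
    _ = ∑ y, if s y z then backSum μ r y else 0 := by
        rw [Finset.sum_comm]
        refine Finset.sum_congr rfl fun y _ => ?_
        by_cases h : s y z
        · simp [h, backSum_eq_ite]
        · simp [h]
    _ ≤ ∑ y, if s y z then A * μ y else 0 := by
        refine Finset.sum_le_sum fun y _ => ?_
        split_ifs
        exacts [h1 y, le_rfl]
    _ = A * backSum μ s z := by
        rw [backSum_eq_ite, Finset.mul_sum]
        exact Finset.sum_congr rfl fun y _ => by split_ifs <;> simp
    _ ≤ A * (B * μ z) := mul_le_mul_of_nonneg_left h2 hA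
    _ = A * B * μ z := by ring

end BackSum

/-! ### Composite moves and chains of moves. -/

/-- Sets `f_i(x)`, after colouring one of the two paths that are joined, if necessary. -/
def ArrowMove [NeZero a] [NeZero b] (m : ℝ) (i : Fin (a - 1)) (x : Fin b) (D D' : PathData a b c) :
    Prop :=
  ∃ D₁, (D₁ = D ∨ ColourMove (srcNode i x) D D₁ ∨
    ∃ x', D'.1 i x = some x' ∧ ColourMove (tgtNode i x') D D₁) ∧ MergeMove m i x D₁ D'

/-- An elementary extension of path data that sets a given variable. -/
def VarMove [NeZero a] [NeZero b] (m : ℝ) : Var a b c → PathData a b c → PathData a b c → Prop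
  | .f i x _ => ArrowMove m i x
  | .G i x _ => ColourMove (i, x)
  | .u x _ => ColourMove (bottomLevel, x)

/-- `D'` arises from `D` by setting some of the variables of a list. -/
def Reach [NeZero a] [NeZero b] (m : ℝ) :
    List (Var a b c) → PathData a b c → PathData a b c → Prop
  | [], D, D' => D' = D
  | v :: L, D, D' => ∃ D₁, (D₁ = D ∨ VarMove m v D D₁) ∧ Reach m L D₁ D'

theorem Reach.refl [NeZero a] [NeZero b] (m : ℝ) (L : List (Var a b c)) (D : PathData a b c) :
    Reach m L D D := by
  induction L with
  | nil => rfl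
  | cons v L ih => exact ⟨D, .inl rfl, ih⟩

theorem Reach.append [NeZero a] [NeZero b] {m : ℝ} {L L' : List (Var a b c)}
    {D D₁ D' : PathData a b c} (h : Reach m L D D₁) (h' : Reach m L' D₁ D') :
    Reach m (L ++ L') D D' := by
  induction L generalizing D with
  | nil => rw [Reach] at h; subst h; exact h'
  | cons v L ih =>
    obtain ⟨D₂, h1, h2⟩ := h
    exact ⟨D₂, h1, ih h2⟩

section Bounds

variable [NeZero a] [NeZero b] [NeZero c] {p q m : ℝ}

theorem backSum_colourMove_le (hp0 : 0 ≤ p) (hp1 : p < 1) (hq0 : 0 ≤ q) (hq1 : q < 1)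
    (v : Node a b) (D' : PathData a b c) :
    backSum (weight p q) (ColourMove v) D' ≤ q * c / (1 - q) * weight p q D' := by
  have : 0 ≤ 1 - q := by linarith
  exact backSum_le_of_unique (weight_nonneg hp0 hp1.le hq0 hq1.le) (by positivity)
    (fun _ _ h1 h2 => h1.unique h2) fun _ h => (h.weight_eq hq1).le

/-- The preparatory step contributes 1 for doing nothing and one colouring ratio for each of the two
paths; the joining contributes the other factor. -/
theorem backSum_arrowMove_le (hp0 : 0 ≤ p) (hp1 : p < 1) (hq0 : 0 ≤ q) (hq1 : q < 1) (hm : 0 ≤ m)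
    (i : Fin (a - 1)) (x : Fin b) (D' : PathData a b c) :
    backSum (weight p q) (ArrowMove m i x) D' ≤
      (1 + 2 * (q * c / (1 - q))) * (p * m / (1 - p)) * weight p q D' := by
  have hμ := weight_nonneg (a := a) (b := b) (c := c) hp0 hp1.le hq0 hq1.le
  have h1 : 0 ≤ 1 - q := by linarith
  have h2 : 0 ≤ 1 - p := by linarith
  have hM : backSum (weight p q) (MergeMove m i x) D' ≤ p * m / (1 - p) * weight p q D' :=
    backSum_le_of_unique hμ (by positivity) (fun _ _ h1 h2 => h1.unique h2)
      fun _ h => h.weight_le hp0 hp1 hq0 hq1.le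
  have hC := fun v => backSum_colourMove_le (a := a) (b := b) (c := c) hp0 hp1 hq0 hq1 v
  -- Fixing the target in advance makes the preparatory relation independent of the intermediate
  -- data. The default 0 is harmless, since colouring the target's path presupposes that `f_i(x)` is
  -- set in `D'`.
  let x₀ : Fin b := (D'.1 i x).getD 0
  refine (backSum_mono (s := fun D D' => ∃ D₁, (D₁ = D ∨ ColourMove (srcNode i x) D D₁ ∨
    ColourMove (tgtNode i x₀) D D₁) ∧ MergeMove m i x D₁ D') hμ ?_).trans
    (backSum_comp_le hμ (by positivity) ?_ hM)
  · rintro D ⟨D₁, h | h | ⟨x', hx', h⟩, h'⟩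
    · exact ⟨D₁, .inl h, h'⟩
    · exact ⟨D₁, .inr (.inl h), h'⟩
    · refine ⟨D₁, .inr (.inr ?_), h'⟩
      simpa only [x₀, hx', Option.getD_some] using h
  · intro D₁
    have e1 := backSum_or_le (r := fun D D₁ => D₁ = D) (s := fun D D₁ =>
      ColourMove (srcNode i x) D D₁ ∨ ColourMove (tgtNode i x₀) D D₁) hμ D₁
    have e2 := backSum_or_le (r := ColourMove (srcNode i x)) (s := ColourMove (tgtNode i x₀)) hμ D₁
    rw [backSum_eq] at e1
    have e3 := hC (srcNode i x) D₁
    have e4 := hC (tgtNode i x₀) D₁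
    linarith

theorem backSum_reach_le (hp0 : 0 ≤ p) (hp1 : p < 1) (hq0 : 0 ≤ q) (hq1 : q < 1) (hm : 0 ≤ m)
    {w : ℝ} (hw1 : q * c / (1 - q) ≤ w)
    (hw2 : (1 + 2 * (q * c / (1 - q))) * (p * m / (1 - p)) ≤ w)
    (L : List (Var a b c)) (D' : PathData a b c) :
    backSum (weight p q) (Reach m L) D' ≤ (1 + w) ^ L.length * weight p q D' := by
  have hμ := weight_nonneg (a := a) (b := b) (c := c) hp0 hp1.le hq0 hq1.le
  have h1 : 0 ≤ 1 - q := by linarith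
  have hw : 0 ≤ w := le_trans (by positivity) hw1
  have hv : ∀ (v : Var a b c) (D' : PathData a b c),
      backSum (weight p q) (VarMove m v) D' ≤ w * weight p q D' := by
    intro v D'
    have hC := fun v => (backSum_colourMove_le (a := a) (b := b) (c := c) hp0 hp1 hq0 hq1 v
      D').trans (mul_le_mul_of_nonneg_right hw1 (hμ D'))
    cases v with
    | f i x j =>
      exact (backSum_arrowMove_le hp0 hp1 hq0 hq1 hm i x D').trans
        (mul_le_mul_of_nonneg_right hw2 (hμ D'))
    | G i x y => exact hC _
    | u x j => exact hC _
  induction L with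
  | nil =>
    simp only [List.length_nil, pow_zero, one_mul]
    exact (backSum_eq D').le
  | cons v L ih =>
    rw [List.length_cons, pow_succ']
    refine backSum_comp_le (r := fun D D₁ => D₁ = D ∨ VarMove m v D D₁) hμ (by positivity) ?_ ih
    intro D₁
    have e1 := backSum_or_le (r := fun D D₁ => D₁ = D) (s := VarMove m v) hμ D₁
    rw [backSum_eq] at e1
    have e2 := hv v D₁
    linarith

/-- `D'` is always among its own sources, by skipping every variable. Removing it turns a bound near
1 into a small one. -/
theorem sum_reach_ne_le (hp0 : 0 ≤ p) (hp1 : p < 1) (hq0 : 0 ≤ q) (hq1 : q < 1) (hm : 0 ≤ m)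
    {w : ℝ} (hw1 : q * c / (1 - q) ≤ w)
    (hw2 : (1 + 2 * (q * c / (1 - q))) * (p * m / (1 - p)) ≤ w)
    (L : List (Var a b c)) (D' : PathData a b c) :
    backSum (weight p q) (fun D D' => Reach m L D D' ∧ D ≠ D') D' ≤
      ((1 + w) ^ L.length - 1) * weight p q D' := by
  classical
  have h := backSum_reach_le hp0 hp1 hq0 hq1 hm hw1 hw2 L D'
  have : backSum (weight p q) (Reach m L) D' = weight p q D' +
      backSum (weight p q) (fun D D' => Reach m L D D' ∧ D ≠ D') D' := by
    simp only [backSum]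
    have e : (Finset.univ.filter fun D => Reach m L D D') =
        insert D' (Finset.univ.filter fun D => Reach m L D D' ∧ D ≠ D') := by
      ext D
      by_cases hD : D = D'
      · subst hD; simp [Reach.refl]
      · simp [hD]
    rw [e, Finset.sum_insert (by simp)]
  linarith

end Bounds

/-! ### Reaching a restriction that falsifies a clause -/

theorem PathData.Le.refl (D : PathData a b c) : D.Le D := ⟨fun _ _ _ h => h, fun _ _ h => h⟩

theorem PathData.Le.trans {D₁ D₂ D₃ : PathData a b c} (h : D₁.Le D₂) (h' : D₂.Le D₃) : D₁.Le D₃ :=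
  ⟨fun _ _ _ e => h'.1 _ _ _ (h.1 _ _ _ e), fun _ _ e => h'.2 _ _ (h.2 _ _ e)⟩

theorem PathData.Le.unsetCard_le {D D' : PathData a b c} (h : D.Le D') (i : Fin (a - 1)) :
    unsetCard (D'.1 i) ≤ unsetCard (D.1 i) := by
  refine Finset.card_le_card fun x hx => ?_
  simp only [Finset.mem_filter, Finset.mem_univ, true_and] at hx ⊢
  rcases hD : D.1 i x with _ | x'
  · rfl
  · simp [h.1 _ _ _ hD] at hx

theorem Valid.recolour_const [NeZero a] [NeZero b] {D : PathData a b c} (hD : Valid D)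
    (v : Node a b) (o : Option (Option (Fin c))) {w w' : Node a b} (h : Arrow D.1 w w') :
    (recolour D v o).2 w = (recolour D v o).2 w' := by
  have h' : Conn D.1 v w ↔ Conn D.1 v w' := Conn.congr_arrow h
  by_cases hw : Conn D.1 v w
  · have hw' := h'.1 hw
    simp only [recolour, hw, hw', if_true]
  · have hw' : ¬ Conn D.1 v w' := fun e => hw (h'.2 e)
    simp only [recolour, hw, hw', if_false, hD.const w w' h]

theorem Valid.recolour [NeZero a] [NeZero b] {D : PathData a b c} (hD : Valid D) {v : Node a b}
    (hv : D.2 v = none) (y : Fin c) : Valid (recolour D v (some (some y))) := by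
  have hnone : ∀ w, (CPLS.recolour D v (some (some y))).2 w = some none →
      D.2 w = some none := by
    intro w hw
    simp only [CPLS.recolour] at hw
    split_ifs at hw
    · simp at hw
    · exact hw
  refine ⟨hD.inj, fun w w' h => ?_, ?_, fun s hs h => hD.start s hs (hnone s h),
    fun w hw => hD.bottom w (hnone w hw)⟩
  · exact hD.recolour_const v _ h
  · have : ¬ Conn D.1 v CPLS.origin := fun h => by
      have := h.eq_of_const hD.const
      simp [hv, hD.origin] at this
    simp only [CPLS.recolour, this, if_false]
    exact hD.origin

theorem Valid.le_recolour [NeZero a] [NeZero b] {D : PathData a b c} (hD : Valid D) {v : Node a b}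
    (hv : D.2 v = none) (o : Option (Option (Fin c))) : D.Le (CPLS.recolour D v o) := by
  refine ⟨fun _ _ _ h => h, fun w t hw => ?_⟩
  have : ¬ Conn D.1 v w := fun h => by
    have := h.eq_of_const hD.const
    simp [hv, hw] at this
  simpa only [CPLS.recolour, this, if_false] using hw

theorem PathData.Le.recolour_le [NeZero a] [NeZero b] {D S : PathData a b c} (h : D.Le S)
    (hS : Valid S) (v : Node a b) : (recolour D v (S.2 v)).Le S := by
  refine ⟨h.1, fun w o hw => ?_⟩
  by_cases hc : Conn D.1 v w
  · simp only [recolour, hc, if_true] at hw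
    rw [← (hc.mono h.1).eq_of_const hS.const, hw]
  · simp only [recolour, hc, if_false] at hw
    exact h.2 _ _ hw

/-! ### Setting one arrow below a given valid extension. -/

section ArrowPhase

variable [NeZero a] [NeZero b] {D S : PathData a b c} {m : ℝ} {i : Fin (a - 1)} {x x' : Fin b}

omit [NeZero a] [NeZero b] in
theorem arrow_src_tgt (F : Fin (a - 1) → Fin b → Option (Fin b)) (h : F i x = some x') :
    Arrow F (srcNode i x) (tgtNode i x') :=
  ⟨i, rfl, rfl, h⟩

theorem Valid.noArrow_tgt (hS : Valid S) (hle : D.Le S) (hx : D.1 i x = none)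
    (hSx : S.1 i x = some x') : NoArrow D.1 (tgtNode i x') := by
  rintro v ⟨j, h1, h2, h3⟩
  have h4 : Arrow S.1 v (tgtNode i x') := ⟨j, h1, h2, hle.1 _ _ _ h3⟩
  have h5 := h4.left_unique hS.inj (arrow_src_tgt S.1 hSx)
  rw [h5] at h1 h3
  obtain rfl : i = j := Fin.ext h1
  simp [srcNode, hx] at h3

/-- Injectivity of `S` makes the target a start in `D`. It lies on a level after the first, so it is
not (0,0), and only the path of (0,0) may be blank. -/
theorem Valid.tgt_ne_blank (hD : Valid D) (hS : Valid S) (hle : D.Le S) (hx : D.1 i x = none)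
    (hSx : S.1 i x = some x') : D.2 (tgtNode i x') ≠ some none := by
  intro h
  have := hD.start _ (hS.noArrow_tgt hle hx hSx) h
  have := congrArg (fun v : Node a b => (v.1 : ℕ)) this
  simp [tgtNode, CPLS.origin] at this

/-- The joined data stay below `S`. This gives injectivity, and also keeps the blank path off the
last level, because it avoids that level in `S`. -/
theorem Valid.exists_mergeMove (hD : Valid D) (hS : Valid S) (hle : D.Le S) (hx : D.1 i x = none)
    (hSx : S.1 i x = some x') (hm : (unsetCard (D.1 i) : ℝ) ≤ m)
    (h : D.2 (srcNode i x) = D.2 (tgtNode i x') ∨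
      (D.2 (srcNode i x) = some none ∧ D.2 (tgtNode i x') = none)) :
    ∃ D', MergeMove m i x D D' ∧ D.Le D' ∧ D'.Le S ∧ D'.1 i x = some x' := by
  have hb := hS.noArrow_tgt hle hx hSx
  have hbt := hD.tgt_ne_blank hS hle hx hSx
  have hF1 : ∀ j z z', D.1 j z = some z' → addArrow D.1 i x x' j z = some z' := by
    intro j z z' hz
    rw [addArrow_of_ne, hz]
    rintro ⟨rfl, rfl⟩
    simp [hx] at hz
  have hF2 : ∀ j z z', addArrow D.1 i x x' j z = some z' → S.1 j z = some z' := by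
    intro j z z' h
    by_cases hj : j = i ∧ z = x
    · obtain ⟨rfl, rfl⟩ := hj
      rw [addArrow_self] at h
      rw [hSx, h]
    · rw [addArrow_of_ne _ _ hj] at h
      exact hle.1 _ _ _ h
  have hst : ∀ s, NoArrow (addArrow D.1 i x x') s → NoArrow D.1 s ∧ s ≠ tgtNode i x' := by
    intro s hs
    refine ⟨fun v hv => hs v ((arrow_addArrow hx _ _ _).2 (.inl hv)), ?_⟩
    rintro rfl
    exact hs _ ((arrow_addArrow hx _ _ _).2 (.inr ⟨rfl, rfl⟩))
  rcases h with h | ⟨h1, h2⟩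
  · have hle' : PathData.Le (addArrow D.1 i x x', D.2) S := ⟨hF2, hle.2⟩
    refine ⟨(addArrow D.1 i x x', D.2), ⟨hD, ⟨?_, ?_, hD.origin, ?_, ?_⟩, hx, hm, x', rfl,
      .inl ⟨h ▸ hbt, rfl⟩⟩, ⟨hF1, fun _ _ h => h⟩, hle', addArrow_self _ _ _ _⟩
    · exact fun j z₁ z₂ z' h₁ h₂ => hS.inj j z₁ z₂ z' (hF2 _ _ _ h₁) (hF2 _ _ _ h₂)
    · intro v w hvw
      rcases (arrow_addArrow hx _ _ _).1 hvw with hvw | ⟨rfl, rfl⟩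
      · exact hD.const _ _ hvw
      · exact h
    · exact fun s hs h => hD.start s (hst s hs).1 h
    · exact fun v hv => hS.bottom v (hle'.2 _ _ hv)
  · have h3 : S.2 (tgtNode i x') = some none := by
      rw [← hS.const _ _ (arrow_src_tgt S.1 hSx)]
      exact hle.2 _ _ h1
    have hle' : PathData.Le (addArrow D.1 i x x', (CPLS.recolour D (tgtNode i x') (some none)).2)
        S := by
      refine ⟨hF2, ?_⟩
      rw [← h3]
      exact (hle.recolour_le hS _).2
    refine ⟨(addArrow D.1 i x x', (CPLS.recolour D (tgtNode i x') (some none)).2),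
      ⟨hD, ⟨?_, ?_, ?_, ?_, ?_⟩, hx, hm, x', rfl, .inr ⟨h1, h2, rfl⟩⟩,
      ⟨hF1, (hD.le_recolour h2 _).2⟩, hle', addArrow_self _ _ _ _⟩
    · exact fun j z₁ z₂ z' h₁ h₂ => hS.inj j z₁ z₂ z' (hF2 _ _ _ h₁) (hF2 _ _ _ h₂)
    · intro v w hvw
      rcases (arrow_addArrow hx _ _ _).1 hvw with hvw | ⟨rfl, rfl⟩
      · exact hD.recolour_const _ _ hvw
      · have : Conn D.1 (tgtNode i x') (tgtNode i x') := .refl _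
        simp only [CPLS.recolour, this, if_true]
        rw [h1, ite_self]
    · exact (hD.le_recolour h2 _).2 _ _ hD.origin
    · intro s hs h
      obtain ⟨hs1, hs2⟩ := hst s hs
      have : ¬ Conn D.1 (tgtNode i x') s := fun h => hs2 (hs1.eq_of_conn hD.inj hb (.symm _ _ h))
      simp only [CPLS.recolour, this, if_false] at h
      exact hD.start s hs1 h
    · exact fun v hv => hS.bottom v (hle'.2 _ _ hv)

/-- In `S` both ends of the arrow have one common state. If exactly one end has a colour in `D`, the
other is uncoloured and first receives the same colour. A blank source absorbs an uncoloured target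
directly, and a blank target is impossible. -/
theorem Valid.exists_arrowMove (hD : Valid D) (hS : Valid S) (hle : D.Le S)
    (hSx : S.1 i x = some x') (hm : (unsetCard (D.1 i) : ℝ) ≤ m) :
    ∃ D', (D' = D ∨ ArrowMove m i x D D') ∧ Valid D' ∧ D.Le D' ∧ D'.Le S ∧ D'.1 i x = some x' := by
  rcases hx : D.1 i x with _ | x''
  swap
  · exact ⟨D, .inl rfl, hD, .refl D, hle, by rw [← hSx, hx, hle.1 _ _ _ hx]⟩
  have hSc : S.2 (srcNode i x) = S.2 (tgtNode i x') := hS.const _ _ (arrow_src_tgt S.1 hSx)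
  have hmerge : ∀ D₁, (D₁ = D ∨ ColourMove (srcNode i x) D D₁ ∨ ColourMove (tgtNode i x') D D₁) →
      Valid D₁ → D.Le D₁ → D₁.Le S → D₁.1 = D.1 → (D₁.2 (srcNode i x) = D₁.2 (tgtNode i x') ∨
      (D₁.2 (srcNode i x) = some none ∧ D₁.2 (tgtNode i x') = none)) →
      ∃ D', (D' = D ∨ ArrowMove m i x D D') ∧ Valid D' ∧ D.Le D' ∧ D'.Le S ∧
        D'.1 i x = some x' := by
    intro D₁ h1 hD₁ h2 h3 h4 h5
    obtain ⟨D', h6, h7, h8, h9⟩ := hD₁.exists_mergeMove hS h3 (by rw [h4, hx]) hSx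
      (m := m) (by rwa [h4]) h5
    refine ⟨D', .inr ⟨D₁, ?_, h6⟩, h6.2.1, h2.trans h7, h8, h9⟩
    rcases h1 with h1 | h1 | h1
    exacts [.inl h1, .inr (.inl h1), .inr (.inr ⟨x', h9, h1⟩)]
  have hcol : ∀ v y, D.2 v = none → S.2 v = some (some y) →
      Valid (CPLS.recolour D v (some (some y))) ∧ D.Le (CPLS.recolour D v (some (some y))) ∧
      (CPLS.recolour D v (some (some y))).Le S ∧
      (CPLS.recolour D v (some (some y))).2 v = some (some y) := by
    intro v y hv hSv
    refine ⟨hD.recolour hv y, hD.le_recolour hv _, hSv ▸ hle.recolour_le hS v, ?_⟩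
    have : Conn D.1 v v := .refl _
    simp only [CPLS.recolour, this, if_true]
  have hbt := hD.tgt_ne_blank hS hle hx hSx
  rcases h1 : D.2 (srcNode i x) with _ | o1 <;> rcases h2 : D.2 (tgtNode i x') with _ | o2
  · exact hmerge D (.inl rfl) hD (.refl D) hle rfl (.inl (by rw [h1, h2]))
  · rcases o2 with _ | y
    · exact absurd h2 hbt
    · obtain ⟨e1, e2, e3, e4⟩ := hcol _ y h1 (by rw [hSc]; exact hle.2 _ _ h2)
      exact hmerge _ (.inr (.inl ⟨hD, h1, y, rfl⟩)) e1 e2 e3 rfl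
        (.inl (by rw [e4, e2.2 _ _ h2]))
  · rcases o1 with _ | y
    · exact hmerge D (.inl rfl) hD (.refl D) hle rfl (.inr ⟨h1, h2⟩)
    · obtain ⟨e1, e2, e3, e4⟩ := hcol _ y h2 (by rw [← hSc]; exact hle.2 _ _ h1)
      exact hmerge _ (.inr (.inr ⟨hD, h2, y, rfl⟩)) e1 e2 e3 rfl
        (.inl (by rw [e4, e2.2 _ _ h1]))
  · refine hmerge D (.inl rfl) hD (.refl D) hle rfl (.inl ?_)
    rw [h1, h2, ← hle.2 _ _ h1, ← hle.2 _ _ h2, hSc]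

end ArrowPhase

/-! ### Setting the colour variables of a clause. -/

/-- The node whose colour a variable describes. -/
def colourNode [NeZero a] : Var a b c → Option (Node a b)
  | .f _ _ _ => none
  | .G i x _ => some (i, x)
  | .u x _ => some (bottomLevel, x)

/-- The value of a colour variable, depending on the state of its path. -/
def colourValue : Var a b c → Option (Option (Fin c)) → Option Bool
  | .f _ _ _, _ => none
  | .G _ _ y, t => t.map fun o => decide (o = some y)
  | .u _ j, t => t.bind fun o => o.map fun y => (y : ℕ).testBit j

theorem encode_eq_colourValue [NeZero a] (D : PathData a b c) {v : Var a b c} {w : Node a b}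
    (h : colourNode v = some w) : encode D v = colourValue v (D.2 w) := by
  cases v <;> simp only [colourNode, Option.some.injEq, reduceCtorEq] at h <;> subst h <;> rfl

theorem varMove_of_colourNode [NeZero a] [NeZero b] (m : ℝ) {v : Var a b c} {w : Node a b}
    (h : colourNode v = some w) : VarMove m v = ColourMove w := by
  cases v <;> simp only [colourNode, Option.some.injEq, reduceCtorEq] at h <;> subst h <;> rfl

theorem Valid.exists_reach_arrows [NeZero a] [NeZero b] {S : PathData a b c} (hS : Valid S) {m : ℝ}
    (L : List (Literal a b c)) {D : PathData a b c} (hD : Valid D) (hle : D.Le S)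
    (hm : ∀ i, (unsetCard (D.1 i) : ℝ) ≤ m)
    (hL : ∀ l ∈ L, colourNode l.1 = none ∧ encode S l.1 ≠ none) :
    ∃ D', Reach m (L.map Prod.fst) D D' ∧ Valid D' ∧ D.Le D' ∧ D'.Le S ∧
      ∀ l ∈ L, encode D' l.1 ≠ none := by
  induction L generalizing D with
  | nil => exact ⟨D, rfl, hD, .refl D, hle, by simp⟩
  | cons l L ih =>
    obtain ⟨h1, h2⟩ := hL l (by simp)
    rcases l with ⟨⟨i, x, j⟩ | _ | _, t⟩
    · rcases hSx : S.1 i x with _ | x'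
      · simp [encode, hSx] at h2
      · obtain ⟨D₁, e1, e2, e3, e4, e5⟩ := hD.exists_arrowMove hS hle hSx (hm i)
        obtain ⟨D', f1, f2, f3, f4, f5⟩ := ih e2 e4
          (fun i => (Nat.cast_le.2 (e3.unsetCard_le i)).trans (hm i))
          fun l hl => hL l (List.mem_cons_of_mem _ hl)
        refine ⟨D', ⟨D₁, e1, f1⟩, f2, e3.trans f3, f4, ?_⟩
        rintro l hl
        rcases List.mem_cons.1 hl with rfl | hl
        · simp [encode, f3.1 _ _ _ e5]
        · exact f5 l hl
    · simp [colourNode] at h1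
    · simp [colourNode] at h1

/-- If the path is coloured in `S`, that colour works. If it is blank in `S`, the clause contains
only `G`-literals on it, all concerning variables with value 0; as the clause has fewer than `c`
literals, some colour is mentioned by none of them and gives the same values. -/
theorem Valid.exists_colour [NeZero a] [NeZero b] [NeZero c] {S : PathData a b c} (hS : Valid S)
    {C : List (Literal a b c)} (hC : ∀ l ∈ C, encode S l.1 = some (!l.2)) (hlen : C.length < c)
    {F : Fin (a - 1) → Fin b → Option (Fin b)} (hF : ∀ i x x', F i x = some x' → S.1 i x = some x')
    {l₀ : Literal a b c} (hl₀ : l₀ ∈ C) {w : Node a b} (hw : colourNode l₀.1 = some w) :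
    ∃ y, ∀ l ∈ C, ∀ w', colourNode l.1 = some w' → Conn F w w' →
      colourValue l.1 (some (some y)) = some (!l.2) := by
  have hSw : ∀ l ∈ C, ∀ w', colourNode l.1 = some w' → Conn F w w' →
      colourValue l.1 (S.2 w) = some (!l.2) := by
    intro l hl w' hw' h
    rw [(h.mono hF).eq_of_const hS.const, ← encode_eq_colourValue S hw', hC l hl]
  rcases h : S.2 w with _ | _ | y
  · have := hSw l₀ hl₀ w hw (.refl _)
    rw [h] at this
    rcases l₀ with ⟨_ | _ | _, t⟩ <;> simp [colourValue] at this
  · let g : Literal a b c → Fin c := fun l => match l.1 with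
      | .G _ _ y => y
      | _ => 0
    obtain ⟨y, hy⟩ : ∃ y, y ∉ (C.map g).toFinset := by
      by_contra! hall
      have h1 := Finset.card_le_card (fun y _ => hall y : Finset.univ ⊆ (C.map g).toFinset)
      have h2 := List.toFinset_card_le (C.map g)
      rw [Finset.card_univ, Fintype.card_fin] at h1
      rw [List.length_map] at h2
      omega
    refine ⟨y, fun l hl w' hw' hww' => ?_⟩
    have h1 := hSw l hl w' hw' hww'
    have h2 : g l ≠ y := fun e => hy (by
      rw [List.mem_toFinset, List.mem_map]; exact ⟨l, hl, e⟩)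
    have h3 : S.2 w' = some none := by rw [← (hww'.mono hF).eq_of_const hS.const, h]
    rw [h] at h1
    rcases l with ⟨_ | ⟨i, x, y'⟩ | ⟨x, j⟩, t⟩
    · simp [colourNode] at hw'
    · simp only [g] at h2
      simp only [colourValue, Option.map_some, Option.some.injEq] at h1 ⊢
      rw [← h1]
      simp [Ne.symm h2]
    · simp [colourValue] at h1
  · exact ⟨y, fun l hl w' hw' hww' => by rw [← h]; exact hSw l hl w' hw' hww'⟩

/-- A path blank in `S` may receive a colour here, so the data need not stay below `S`. What
persists is that the arrows belong to `S` and that no literal of the clause becomes true. -/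
theorem Valid.exists_reach_colours [NeZero a] [NeZero b] [NeZero c] {S : PathData a b c}
    (hS : Valid S) {C : List (Literal a b c)} (hC : ∀ l ∈ C, encode S l.1 = some (!l.2))
    (hlen : C.length < c) {m : ℝ} (L : List (Literal a b c)) {D : PathData a b c} (hD : Valid D)
    (hF : ∀ i x x', D.1 i x = some x' → S.1 i x = some x')
    (hDC : ∀ l ∈ C, encode D l.1 ≠ some l.2)
    (hL : ∀ l ∈ L, l ∈ C ∧ colourNode l.1 ≠ none) :
    ∃ D', Reach m (L.map Prod.fst) D D' ∧ Valid D' ∧ D.Le D' ∧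
      (∀ l ∈ C, encode D' l.1 ≠ some l.2) ∧ ∀ l ∈ L, encode D' l.1 ≠ none := by
  induction L generalizing D with
  | nil => exact ⟨D, rfl, hD, .refl D, hDC, by simp⟩
  | cons l L ih =>
    obtain ⟨hl1, hl2⟩ := hL l (by simp)
    obtain ⟨w, hw⟩ := Option.ne_none_iff_exists'.1 hl2
    obtain ⟨D₁, e1, e2, e3, e4, e5, e6⟩ : ∃ D₁, (D₁ = D ∨ VarMove m l.1 D D₁) ∧ Valid D₁ ∧
        D.Le D₁ ∧ D₁.1 = D.1 ∧ (∀ l ∈ C, encode D₁ l.1 ≠ some l.2) ∧ encode D₁ l.1 ≠ none := by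
      by_cases hDl : encode D l.1 = none
      swap
      · exact ⟨D, .inl rfl, hD, .refl D, rfl, hDC, hDl⟩
      obtain ⟨y, hy⟩ := hS.exists_colour hC hlen hF hl1 hw
      -- On a blank path every `G`-variable is set, and no `u`-variable belongs to it because it
      -- misses the last level. So an unset colour variable indicates an uncoloured path.
      have hDw : D.2 w = none := by
        rcases hDw : D.2 w with _ | _ | y'
        · rfl
        · rcases l with ⟨_ | ⟨i, x, y'⟩ | ⟨x, j⟩, t⟩
          · simp [colourNode] at hw
          · rw [encode_eq_colourValue D hw, hDw] at hDl
            simp [colourValue] at hDl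
          · simp only [colourNode, Option.some.injEq] at hw
            refine absurd ?_ (hD.bottom w hDw)
            have := NeZero.pos a
            subst hw
            simp only [IsBottom, bottomLevel]
            omega
        · rw [encode_eq_colourValue D hw, hDw] at hDl
          rcases l with ⟨_ | _ | _, t⟩
          · simp [colourNode] at hw
          · simp [colourValue] at hDl
          · simp [colourValue] at hDl
      have hval : ∀ l' ∈ C, ∀ w', colourNode l'.1 = some w' → Conn D.1 w w' →
          encode (CPLS.recolour D w (some (some y))) l'.1 = some (!l'.2) := by
        intro l' hl' w' hw' hc
        rw [encode_eq_colourValue _ hw']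
        simp only [CPLS.recolour, hc, if_true]
        exact hy l' hl' w' hw' hc
      refine ⟨CPLS.recolour D w (some (some y)), .inr ?_, hD.recolour hDw y, hD.le_recolour hDw _,
        rfl, ?_, ?_⟩
      · rw [varMove_of_colourNode m hw]
        exact ⟨hD, hDw, y, rfl⟩
      · intro l' hl'
        rcases hw' : colourNode l'.1 with _ | w'
        · have : encode (CPLS.recolour D w (some (some y))) l'.1 = encode D l'.1 := by
            rcases l' with ⟨_ | _ | _, t⟩
            · rfl
            · simp [colourNode] at hw'
            · simp [colourNode] at hw'
          rw [this]
          exact hDC l' hl'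
        · by_cases hc : Conn D.1 w w'
          · rw [hval l' hl' w' hw' hc]
            simp
          · rw [encode_eq_colourValue _ hw']
            simp only [CPLS.recolour, hc, if_false]
            rw [← encode_eq_colourValue _ hw']
            exact hDC l' hl'
      · rw [hval l hl1 w hw (.refl _)]
        simp
    obtain ⟨D', f1, f2, f3, f4, f5⟩ := ih e2 (by rwa [e4]) e5
      fun l hl => hL l (List.mem_cons_of_mem _ hl)
    refine ⟨D', ⟨D₁, e1, f1⟩, f2, e3.trans f3, f4, fun l' hl' => ?_⟩
    rcases List.mem_cons.1 hl' with rfl | hl'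
    · obtain ⟨t, ht⟩ := Option.ne_none_iff_exists'.1 e6
      rw [f3.extends _ _ ht]
      simp
    · exact f5 l' hl'

/-- The variables of a clause, with the variables describing the `f_i` first. -/
def clauseVars [NeZero a] (C : List (Literal a b c)) : List (Var a b c) :=
  (C.filter fun l => (colourNode l.1).isNone).map Prod.fst ++
    (C.filter fun l => !(colourNode l.1).isNone).map Prod.fst

theorem length_clauseVars [NeZero a] (C : List (Literal a b c)) :
    (clauseVars C).length = C.length := by
  simp only [clauseVars, List.length_append, List.length_map]
  exact (List.length_eq_length_filter_add _).symm

/-- Arrows come before colours because choosing arrows requires being below `S`, which colouring may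
destroy. -/
theorem Valid.exists_reach_falsifying [NeZero a] [NeZero b] [NeZero c] {D S : PathData a b c}
    (hD : Valid D) (hS : Valid S) (hle : D.Le S) {m : ℝ}
    (hm : ∀ i, (unsetCard (D.1 i) : ℝ) ≤ m) {C : List (Literal a b c)} (hlen : C.length < c)
    (hC : ∀ l ∈ C, encode S l.1 = some (!l.2)) :
    ∃ D', Reach m (clauseVars C) D D' ∧ Valid D' ∧ D.Le D' ∧
      ∀ l ∈ C, encode D' l.1 = some (!l.2) := by
  obtain ⟨D₁, e1, e2, e3, e4, e5⟩ := hS.exists_reach_arrows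
    (C.filter fun l => (colourNode l.1).isNone) hD hle hm fun l hl => by
      rw [List.mem_filter] at hl
      exact ⟨by simpa using hl.2, by simp [hC l hl.1]⟩
  obtain ⟨D', f1, f2, f3, f4, f5⟩ := hS.exists_reach_colours hC hlen (m := m)
    (C.filter fun l => !(colourNode l.1).isNone) e2 e4.1 (fun l hl h => by
      have := e4.extends _ _ h
      rw [hC l hl] at this
      simp at this) fun l hl => by
      rw [List.mem_filter] at hl
      exact ⟨hl.1, by simpa [Option.isSome_iff_ne_none] using hl.2⟩
  refine ⟨D', e1.append f1, f2, e3.trans f3, fun l hl => ?_⟩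
  have h1 : encode D' l.1 ≠ none := by
    by_cases h : (colourNode l.1).isNone
    · obtain ⟨t, ht⟩ := Option.ne_none_iff_exists'.1 (e5 l (List.mem_filter.2 ⟨hl, h⟩))
      simp [f3.extends _ _ ht]
    · exact f5 l (List.mem_filter.2 ⟨hl, by simpa [Option.isSome_iff_ne_none] using h⟩)
  obtain ⟨t, ht⟩ := Option.ne_none_iff_exists'.1 h1
  have h2 := f4 l hl
  rw [ht] at h2 ⊢
  rcases t <;> rcases h3 : l.2 <;> simp_all

/-! ### The probability of a restriction described by path data -/

theorem coin_toReal (r : ℝ≥0) (hr : r ≤ 1) (t : Bool) :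
    (coin r hr t).toReal = if t then (r : ℝ) else 1 - r := by
  cases t
  · simp [coin, ENNReal.toReal_sub_of_le, hr]
  · simp [coin]

theorem indep_toReal {ι : Type} [Fintype ι] {β : ι → Type} [∀ i, Fintype (β i)]
    (μ : ∀ i, PMF (β i)) (g : ∀ i, β i) : (indep μ g).toReal = ∏ i, (μ i (g i)).toReal := by
  simp only [indep, PMF.ofFintype_apply]
  rw [ENNReal.toReal_prod]

theorem prod_coin_toReal (p : ℝ≥0) (hp : p ≤ 1) (g : Fin b → Option (Fin b)) :
    ∏ x, (coin p hp (g x).isNone).toReal = (p : ℝ) ^ unsetCard g * (1 - p) ^ setCard g := by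
  simp only [coin_toReal]
  rw [Finset.prod_ite, Finset.prod_const, Finset.prod_const]
  simp [unsetCard, setCard]

theorem card_isNone_eq_false (g : Fin b → Option (Fin b)) :
    Fintype.card {x : Fin b // (g x).isNone = false} = setCard g := by
  rw [Fintype.card_subtype, setCard]
  congr 1
  ext x
  simp [Option.isSome_iff_ne_none]

/-- Exactly one domain and one embedding produce `g`; the falling factorial counts the embeddings of
that domain. -/
theorem randomPartialInjection_toReal (p : ℝ≥0) (hp : p ≤ 1) {g : Fin b → Option (Fin b)}
    (hg : ∀ x₁ x₂ x', g x₁ = some x' → g x₂ = some x' → x₁ = x₂) :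
    (randomPartialInjection b p hp g).toReal = levelWeight p g := by
  classical
  simp only [randomPartialInjection, PMF.bind_apply]
  rw [tsum_eq_single (fun x => (g x).isNone)]
  · rw [ENNReal.toReal_mul, indep_toReal, prod_coin_toReal, levelWeight, mul_div_assoc,
      div_eq_mul_inv, ← mul_assoc]
    congr 1
    have hsome : ∀ x : {x : Fin b // (g x).isNone = false}, ∃ x', g x = some x' := fun x =>
      Option.ne_none_iff_exists'.1 fun h => by simpa [h] using x.2
    choose e he using hsome
    have einj : Function.Injective e := fun x₁ x₂ h => Subtype.ext
      (hg _ _ _ (he x₁) (by rw [h]; exact he x₂))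
    have hne : Nonempty ({x : Fin b // (g x).isNone = false} ↪ Fin b) := ⟨⟨e, einj⟩⟩
    rw [PMF.map_apply, tsum_eq_single ⟨e, einj⟩]
    · rw [if_pos]
      · rw [PMF.uniformOfFintype_apply, Fintype.card_embedding_eq, card_isNone_eq_false,
          Fintype.card_fin]
        simp
      · funext x
        by_cases hx : (g x).isNone = false
        · rw [dif_pos hx]
          exact he ⟨x, hx⟩
        · rw [dif_neg hx]
          simpa using hx
    · intro e' he'
      rw [if_neg]
      rintro hge
      refine he' (Function.Embedding.ext fun x => ?_)
      have := congrFun hge x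
      rw [dif_pos x.2, he x] at this
      exact (Option.some.inj this).symm
  · intro out hout
    rw [PMF.map_apply, mul_eq_zero]
    right
    rw [ENNReal.tsum_eq_zero]
    intro e
    rw [if_neg]
    rintro rfl
    refine hout (funext fun x => ?_)
    rcases h : out x <;> simp [h]

theorem randomColour_toReal [NeZero c] (q : ℝ≥0) (hq : q ≤ 1) (o : Option (Fin c)) :
    (randomColour c q hq o).toReal = colourWeight (q : ℝ) (o.map (some : Fin c → _)) := by
  classical
  simp only [randomColour, PMF.bind_apply]
  rw [tsum_fintype, Fintype.sum_bool]
  simp only [cond_true, cond_false, PMF.pure_apply, PMF.map_apply]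
  rcases o with _ | y
  · simp [colourWeight, coin]
  · rw [tsum_eq_single y]
    · simp [colourWeight, coin, ENNReal.toReal_sub_of_le, hq, div_eq_mul_inv]
    · intro y' hy'
      rw [if_neg]
      simpa using fun h => hy' h.symm

theorem path_fRestriction (hb : ∃ β, 0 < β ∧ b = 2 ^ β)
    (F : Fin (a - 1) → Fin b → Option (Fin b)) (s : Node a b) :
    path (fRestriction c F) s = {v | Relation.ReflTransGen (Arrow F) s v} := by
  rw [path, edge_eq hb (F := F) fun _ _ _ => rfl]

theorem isStart_fRestriction (hb : ∃ β, 0 < β ∧ b = 2 ^ β)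
    (F : Fin (a - 1) → Fin b → Option (Fin b)) (s : Node a b) :
    IsStart (fRestriction c F) s ↔ NoArrow F s := by
  rw [IsStart, NoArrow, edge_eq hb (F := F) fun _ _ _ => rfl]

section

variable [NeZero a] [NeZero b]

theorem noArrow_origin (F : Fin (a - 1) → Fin b → Option (Fin b)) :
    NoArrow F (origin : Node a b) := by
  rintro v ⟨i, -, h, -⟩
  simp [origin] at h

theorem nodeColour_eq (hb : ∃ β, 0 < β ∧ b = 2 ^ β) {F : Fin (a - 1) → Fin b → Option (Fin b)}
    (hF : ∀ i x₁ x₂ x', F i x₁ = some x' → F i x₂ = some x' → x₁ = x₂)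
    (χ : OtherStart (fRestriction c F) → Option (Fin c)) (s : OtherStart (fRestriction c F))
    {v : Node a b} (h : Relation.ReflTransGen (Arrow F) s.1 v) :
    nodeColour (fRestriction c F) χ v = χ s := by
  have hex : ∃ s : OtherStart (fRestriction c F), v ∈ path (fRestriction c F) s.1 :=
    ⟨s, by rw [path_fRestriction hb]; exact h⟩
  rw [nodeColour, dif_pos hex]
  congr 1
  have h1 := hex.choose_spec
  rw [path_fRestriction hb] at h1
  refine Subtype.ext (NoArrow.eq_of_conn hF ((isStart_fRestriction hb F _).1 hex.choose.2.1)
    ((isStart_fRestriction hb F _).1 s.2.1) ?_)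
  exact .trans _ _ _ (conn_of_reflTransGen h1) (.symm _ _ (conn_of_reflTransGen h))

/-- The colours of the paths other than the path of `(0, 0)`. -/
def PathData.colours (D : PathData a b c) : OtherStart (fRestriction c D.1) → Option (Fin c) :=
  fun s => (D.2 s.1).join

theorem Valid.map_join (hb : ∃ β, 0 < β ∧ b = 2 ^ β) {D : PathData a b c} (hD : Valid D)
    (s : OtherStart (fRestriction c D.1)) :
    (D.colours s).map (some : Fin c → _) = D.2 s.1 := by
  simp only [PathData.colours]
  rcases h : D.2 s.1 with _ | _ | y
  · rfl
  · exact absurd (hD.start _ ((isStart_fRestriction hb _ _).1 s.2.1) h) s.2.2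
  · rfl

theorem Valid.colourRestriction_colours (hb : ∃ β, 0 < β ∧ b = 2 ^ β) {D : PathData a b c}
    (hD : Valid D) : colourRestriction (fRestriction c D.1) D.colours = encode D := by
  have key : ∀ v : Node a b, (v ∈ path (fRestriction c D.1) CPLS.origin ∧ D.2 v = some none) ∨
      (v ∉ path (fRestriction c D.1) CPLS.origin ∧
        D.2 v = (nodeColour (fRestriction c D.1) D.colours v).map some) := by
    intro v
    obtain ⟨s, hs, hsv⟩ := exists_noArrow D.1 v
    have hv := (conn_of_reflTransGen hsv).eq_of_const hD.const
    rw [path_fRestriction hb]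
    by_cases h0 : s = CPLS.origin
    · subst h0
      exact .inl ⟨hsv, by rw [← hv, hD.origin]⟩
    · refine .inr ⟨fun h => h0 ?_, ?_⟩
      · exact hs.eq_of_conn hD.inj (noArrow_origin D.1)
          (.trans _ _ _ (conn_of_reflTransGen hsv) (.symm _ _ (conn_of_reflTransGen h)))
      · rw [nodeColour_eq hb hD.inj D.colours ⟨s, (isStart_fRestriction hb _ _).2 hs, h0⟩ hsv,
          hD.map_join hb, hv]
  funext v
  cases v with
  | f i x j => rfl
  | G i x y =>
    simp only [colourRestriction, encode]
    rcases key (i, x) with ⟨h1, h2⟩ | ⟨h1, h2⟩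
    · rw [if_pos h1, h2]
      simp
    · rw [if_neg h1, h2, Option.map_map]
      congr 1
      funext y'
      simp [eq_comm]
  | u x j =>
    simp only [colourRestriction, encode]
    rcases key (bottomLevel, x) with ⟨h1, h2⟩ | ⟨h1, h2⟩
    · refine absurd ?_ (hD.bottom _ h2)
      have := NeZero.pos a
      simp only [IsBottom, bottomLevel]
      omega
    · rw [h2]
      rcases h : nodeColour (fRestriction c D.1) D.colours (bottomLevel, x) with _ | y
      · simp only [bottomLevel] at h
        rw [h]
        rfl
      · simp only [bottomLevel] at h
        rw [h]
        rfl

theorem Valid.colours_unique [NeZero c] (hb : ∃ β, 0 < β ∧ b = 2 ^ β) {D : PathData a b c}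
    (hD : Valid D) {χ : OtherStart (fRestriction c D.1) → Option (Fin c)}
    (h : colourRestriction (fRestriction c D.1) χ = encode D) : χ = D.colours := by
  funext s
  have hs0 : (s.1.1, s.1.2) ∉ path (fRestriction c D.1) CPLS.origin := by
    rw [path_fRestriction hb]
    intro h
    exact s.2.2 (((isStart_fRestriction hb _ _).1 s.2.1).eq_of_reflTransGen h).symm
  have h1 : (χ s).map (some : Fin c → _) = D.2 s.1 := by
    refine map_decide_injective fun y => ?_
    have h2 := congrFun h (.G s.1.1 s.1.2 y)
    simp only [colourRestriction, encode] at h2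
    rw [if_neg hs0, nodeColour_eq hb hD.inj χ s .refl] at h2
    rw [← h2, Option.map_map]
    congr 1
    funext y'
    simp [eq_comm]
  rw [PathData.colours, ← h1]
  cases χ s <;> rfl

/-- The restriction determines the random choices: its `f`-variables give the functions, and the
starts of the other paths give the colours. Both sums over choices therefore collapse to one term.
-/
theorem Valid.randomRestriction_toReal [NeZero c] (hb : ∃ β, 0 < β ∧ b = 2 ^ β)
    {D : PathData a b c} (hD : Valid D) (p q : ℝ≥0) (hp : p ≤ 1) (hq : q ≤ 1) :
    (randomRestriction a b c p q hp hq (encode D)).toReal = weight p q D := by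
  classical
  simp only [randomRestriction, PMF.bind_apply]
  rw [tsum_eq_single D.1]
  · rw [ENNReal.toReal_mul, indep_toReal, weight]
    congr 1
    · exact Finset.prod_congr rfl fun i _ => randomPartialInjection_toReal p hp (hD.inj i)
    · rw [PMF.map_apply, tsum_eq_single D.colours, if_pos (hD.colourRestriction_colours hb).symm,
        indep_toReal]
      · simp only [randomColour_toReal, hD.map_join hb, colourProd]
        rw [← Finset.prod_filter]
        refine (Finset.prod_subtype _ (fun v => ?_) fun v => colourWeight (q : ℝ) (D.2 v)).symm
        simp [isStart_fRestriction hb]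
      · intro χ hχ
        rw [if_neg]
        exact fun h => hχ (hD.colours_unique hb h.symm)
  · intro F hF
    rw [mul_eq_zero]
    right
    rw [PMF.map_apply, ENNReal.tsum_eq_zero]
    intro χ
    rw [if_neg]
    intro h
    refine hF (funext fun i => funext fun x => Option.ext fun x' => ?_)
    rw [← fVal_iff hb (ρ := encode D) (F := D.1) fun _ _ _ => rfl, h]
    exact (fVal_iff hb (fun _ _ _ => rfl) i x x').symm

theorem randomRestriction_origin [NeZero c] {p q : ℝ≥0} {hp : p ≤ 1} {hq : q ≤ 1}
    {ρ : Restriction a b c} (h : randomRestriction a b c p q hp hq ρ ≠ 0) :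
    ρ (.G 0 0 0) = some false := by
  classical
  rw [← PMF.mem_support_iff] at h
  simp only [randomRestriction, PMF.mem_support_bind_iff, PMF.mem_support_map_iff] at h
  obtain ⟨F, -, χ, -, rfl⟩ := h
  simp only [colourRestriction]
  exact if_pos Relation.ReflTransGen.refl

end

instance : Finite (Var a b c) := by
  refine Finite.of_injective (β := (Fin (a - 1) × Fin b × Fin (Nat.log 2 b)) ⊕
    (Fin a × Fin b × Fin c) ⊕ (Fin b × Fin (Nat.log 2 c))) (fun v => match v with
      | .f i x j => .inl (i, x, j)
      | .G i x y => .inr (.inl (i, x, y))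
      | .u x j => .inr (.inr (x, j))) ?_
  rintro (_ | _ | _) (_ | _ | _) h <;> simp_all

noncomputable instance : Fintype (Restriction a b c) := Fintype.ofFinite _

end

/-! ### The probability of not fixing a CNF -/

section Prob

variable {n c : ℕ} [NeZero n] [NeZero c]

theorem prob_eq_sum (E : Set (Restriction n n c)) [DecidablePred (· ∈ E)] :
    prob E = ∑ ρ with ρ ∈ E, (R n c ρ).toReal := by
  classical
  rw [prob, PMF.toOuterMeasure_apply_fintype, ENNReal.toReal_sum, Finset.sum_filter]
  · refine Finset.sum_congr rfl fun ρ _ => ?_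
    by_cases h : ρ ∈ E <;> simp [h]
  · intro ρ _
    by_cases h : ρ ∈ E <;> simp [h, PMF.apply_ne_top]

theorem prob_nonneg (E : Set (Restriction n n c)) : 0 ≤ prob E := ENNReal.toReal_nonneg

theorem prob_mono {E E' : Set (Restriction n n c)} (h : E ⊆ E') : prob E ≤ prob E' := by
  classical
  rw [prob_eq_sum, prob_eq_sum]
  refine Finset.sum_le_sum_of_subset_of_nonneg (fun ρ hρ => ?_) fun _ _ _ => ENNReal.toReal_nonneg
  simp only [Finset.mem_filter, Finset.mem_univ, true_and] at hρ ⊢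
  exact h hρ

theorem prob_union_le (E E' : Set (Restriction n n c)) : prob (E ∪ E') ≤ prob E + prob E' := by
  classical
  rw [prob_eq_sum, prob_eq_sum, prob_eq_sum]
  simp only [Finset.sum_filter, ← Finset.sum_add_distrib]
  refine Finset.sum_le_sum fun ρ _ => ?_
  have : 0 ≤ (R n c ρ).toReal := ENNReal.toReal_nonneg
  by_cases h1 : ρ ∈ E <;> by_cases h2 : ρ ∈ E' <;> simp [h1, h2]

theorem prob_univ : prob (Set.univ : Set (Restriction n n c)) = 1 := by
  have : (R n c).toOuterMeasure Set.univ = 1 :=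
    (PMF.toOuterMeasure_apply_eq_one_iff _ _).2 (Set.subset_univ _)
  rw [prob, this, ENNReal.toReal_one]

theorem prob_biUnion_le {ι : Type*} (s : Finset ι) (E : ι → Set (Restriction n n c)) :
    prob (⋃ i ∈ s, E i) ≤ ∑ i ∈ s, prob (E i) := by
  classical
  induction s using Finset.induction_on with
  | empty => simp [prob]
  | insert i s hi ih =>
    rw [Finset.set_biUnion_insert, Finset.sum_insert hi]
    exact (prob_union_le _ _).trans (by linarith)

theorem sum_prob_le_one {ι : Type*} (s : Finset ι) (E : ι → Set (Restriction n n c))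
    (hE : ∀ i ∈ s, ∀ j ∈ s, ∀ ρ, ρ ∈ E i → ρ ∈ E j → i = j) : ∑ i ∈ s, prob (E i) ≤ 1 := by
  classical
  rw [← prob_univ (n := n) (c := c), prob_eq_sum]
  simp only [prob_eq_sum, Finset.sum_filter]
  rw [Finset.sum_comm]
  refine Finset.sum_le_sum fun ρ _ => ?_
  simp only [Set.mem_univ, if_true]
  have h0 : 0 ≤ (R n c ρ).toReal := ENNReal.toReal_nonneg
  by_cases h : ∃ i ∈ s, ρ ∈ E i
  · obtain ⟨i, hi, hρ⟩ := h
    rw [Finset.sum_eq_single_of_mem i hi, if_pos hρ]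
    exact fun j hj hji => if_neg fun hρ' => hji (hE j hj i hi ρ hρ' hρ)
  · push Not at h
    rw [Finset.sum_eq_zero fun i hi => if_neg (h i hi)]
    exact h0

end Prob

theorem Good.unsetCard_le {n c : ℕ} [NeZero n] {D : PathData n n c} (h : Good (encode D))
    (hb : ∃ β, 0 < β ∧ n = 2 ^ β) (i : Fin (n - 1)) :
    (unsetCard (D.1 i) : ℝ) ≤ 2 * (n : ℝ) ^ (3 / 7 : ℝ) := by
  refine le_trans (le_of_eq ?_) (h.unset_upper i)
  congr 1
  rw [unsetCard, ← Set.ncard_coe_finset]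
  congr 1
  ext x
  simp [fVal_iff hb (ρ := encode D) (F := D.1) fun _ _ _ => rfl, Option.eq_none_iff_forall_ne_some]

section Fixing

variable {n c k : ℕ} [NeZero n] [NeZero c]

open scoped Classical in
/-- Every literal of the clause is set to `0`. -/
noncomputable def falsifiesClause (ρ : Restriction n n c) (C : List (Literal n n c)) : Bool :=
  decide (∀ l ∈ C, ρ l.1 = some (!l.2))

/-- The first clause of a CNF that is falsified. -/
noncomputable def firstFalsified (B : CNF n n c) (ρ : Restriction n n c) : List (Literal n n c) :=
  (B.find? (falsifiesClause ρ)).getD []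

omit [NeZero n] [NeZero c] in
theorem length_firstFalsified_le (B : KCNF n n c k) (ρ : Restriction n n c) :
    (firstFalsified B.1 ρ).length ≤ k := by
  rw [firstFalsified]
  rcases h : B.1.find? (falsifiesClause ρ) with _ | C
  · exact Nat.zero_le k
  · exact B.2 C (List.mem_of_find?_eq_some h)

/-- The point is that the list of variables is computed from `D'`. The clause is chosen as the first
one falsified by some legal extension of `D`, not merely by one given extension; hence `D'`, being
such an extension, falsifies no earlier clause. -/
theorem Valid.exists_reach_of_not_fixes {D : PathData n n c} (hD : Valid D)
    (hb : ∃ β, 0 < β ∧ n = 2 ^ β) (hk : k < c) (hgood : Good (encode D)) (B : KCNF n n c k)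
    (hB : ∀ e, ¬ Fixes (encode D) B.1 e) :
    ∃ D', Reach (2 * (n : ℝ) ^ (3 / 7 : ℝ)) (clauseVars (firstFalsified B.1 (encode D'))) D D' ∧
      D ≠ D' ∧ Valid D' ∧ D.Le D' := by
  classical
  have h0 : ¬ Falsifies (encode D) B.1 := hB false
  have h1 : ¬ ∀ σ, Extends σ (encode D) → Legal σ → ¬ Falsifies σ B.1 := hB true
  push Not at h1
  obtain ⟨σ₀, hσ₀, hleg₀, C₀, hC₀, hf₀⟩ := h1
  let P : List (Literal n n c) → Bool := fun C =>
    decide (∃ σ, Extends σ (encode D) ∧ Legal σ ∧ ∀ l ∈ C, σ l.1 = some (!l.2))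
  have hsome : (B.1.find? P).isSome := by
    rw [List.find?_isSome]
    exact ⟨C₀, hC₀, by simpa [P] using ⟨σ₀, hσ₀, hleg₀, by simpa using hf₀⟩⟩
  obtain ⟨C, hC⟩ := Option.isSome_iff_exists.1 hsome
  obtain ⟨hPC, L₁, L₂, hL, hL₁⟩ := List.find?_eq_some_iff_append.1 hC
  obtain ⟨σ, hσ, hleg, hf⟩ := of_decide_eq_true hPC
  have hCB : C ∈ B.1 := List.mem_of_find?_eq_some hC
  obtain ⟨S, hS, rfl⟩ := hleg.exists_valid (hσ _ _ (by
    have := hD.origin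
    simp only [CPLS.origin] at this
    simp [encode, this])) hb
  obtain ⟨D', e1, e2, e3, e4⟩ := hD.exists_reach_falsifying hS (Extends.le hb hσ)
    (hgood.unsetCard_le hb) (lt_of_le_of_lt (B.2 C hCB) hk) hf
  have hfind : B.1.find? (falsifiesClause (encode D')) = some C := by
    rw [List.find?_eq_some_iff_append]
    refine ⟨decide_eq_true e4, L₁, L₂, hL, fun C' hC' => ?_⟩
    have := hL₁ C' hC'
    by_contra hcon
    simp only [falsifiesClause, Bool.not_eq_true', decide_eq_false_iff_not, not_not, P] at this hcon
    exact this ⟨_, e3.extends, e2.legal hb, hcon⟩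
  refine ⟨D', ?_, ?_, e2, e3⟩
  · rw [firstFalsified, hfind]
    exact e1
  · rintro rfl
    exact h0 ⟨C, hCB, e4⟩

theorem prob_not_fixes_le (hb : ∃ β, 0 < β ∧ n = 2 ^ β) (hk : k < c) (B : KCNF n n c k)
    {P : Restriction n n c → Prop}
    (hP : ∀ ρ σ, P ρ → Extends σ ρ → Legal σ → P σ) {p q m w : ℝ}
    (hp : p = (n : ℝ) ^ (-(4 / 7 : ℝ))) (hq : q = (n : ℝ) ^ (-(2 / 7 : ℝ)))
    (hm : m = 2 * (n : ℝ) ^ (3 / 7 : ℝ)) (hp1 : p < 1) (hq1 : q < 1)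
    (hw1 : q * c / (1 - q) ≤ w)
    (hw2 : (1 + 2 * (q * c / (1 - q))) * (p * m / (1 - p)) ≤ w) :
    prob {ρ : Restriction n n c | Good ρ ∧ P ρ ∧ ∀ e, ¬ Fixes ρ B.1 e} ≤
      ((1 + w) ^ k - 1) * (prob {ρ : Restriction n n c | Good ρ ∧ P ρ} + badProb n c) := by
  classical
  have hp0 : 0 ≤ p := by rw [hp]; positivity
  have hq0 : 0 ≤ q := by rw [hq]; positivity
  have hm0 : 0 ≤ m := by rw [hm]; positivity
  have hw : 0 ≤ w := by
    have : 0 ≤ 1 - q := by linarith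
    exact le_trans (by positivity) hw1
  have hμ := weight_nonneg (a := n) (b := n) (c := c) hp0 hp1.le hq0 hq1.le
  have hR : ∀ {D : PathData n n c}, Valid D → (R n c (encode D)).toReal = weight p q D := by
    intro D hD
    rw [R, hD.randomRestriction_toReal hb, hp, hq]
    norm_cast
  have hsup : ∀ {ρ : Restriction n n c}, Legal ρ → (R n c ρ).toReal ≠ 0 →
      ∃ D, Valid D ∧ encode D = ρ := by
    intro ρ hρ h
    have h1 : R n c ρ ≠ 0 := fun h0 => h (by rw [h0, ENNReal.toReal_zero])
    exact hρ.exists_valid (randomRestriction_origin h1) hb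
  set U := {ρ : Restriction n n c | Good ρ ∧ P ρ ∧ ∀ e, ¬ Fixes ρ B.1 e} with hU
  let V : Finset (PathData n n c) := Finset.univ.filter fun D => Valid D ∧ encode D ∈ U
  let W : Finset (PathData n n c) := Finset.univ.filter fun D => Valid D ∧ P (encode D)
  let r : PathData n n c → PathData n n c → Prop := fun D D' =>
    Reach m (clauseVars (firstFalsified B.1 (encode D'))) D D' ∧ D ≠ D'
  -- Restrictions of probability 0 are discarded first, since the others have a blank path at (0,0)
  -- and hence come from path data.
  have h1 : prob U ≤ ∑ D ∈ V, weight p q D := by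
    calc prob U = ∑ ρ with ρ ∈ U, (R n c ρ).toReal := prob_eq_sum U
      _ = ∑ ρ ∈ Finset.univ.filter (fun ρ => ρ ∈ U) with (R n c ρ).toReal ≠ 0,
          (R n c ρ).toReal := (Finset.sum_filter_ne_zero _).symm
      _ ≤ ∑ ρ ∈ V.image encode, (R n c ρ).toReal := by
          refine Finset.sum_le_sum_of_subset_of_nonneg (fun ρ hρ => ?_)
            fun _ _ _ => ENNReal.toReal_nonneg
          simp only [Finset.mem_filter, Finset.mem_univ, true_and] at hρ
          obtain ⟨D, hD, rfl⟩ := hsup hρ.1.1.legal hρ.2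
          exact Finset.mem_image_of_mem _ (by simpa [V] using ⟨hD, hρ.1⟩)
      _ = ∑ D ∈ V, (R n c (encode D)).toReal :=
          Finset.sum_image fun _ _ _ _ h => encode_injective hb h
      _ = ∑ D ∈ V, weight p q D := by
          refine Finset.sum_congr rfl fun D hD => hR ?_
          simp only [V, Finset.mem_filter] at hD
          exact hD.2.1
  -- Double counting: every `D` in `V` has at least one partner `D'`, which lies in `W` because `P`
  -- survives legal extension.
  have h2 : ∑ D ∈ V, weight p q D ≤ ∑ D' ∈ W, backSum (weight p q) r D' := by
    simp only [backSum_eq_ite]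
    rw [Finset.sum_comm]
    have h0 : ∀ D D', 0 ≤ if r D D' then weight p q D else 0 := by
      intro D D'
      split_ifs
      exacts [hμ D, le_rfl]
    refine (Finset.sum_le_sum fun D hD => ?_).trans (Finset.sum_le_sum_of_subset_of_nonneg
      (Finset.subset_univ V) fun D _ _ => Finset.sum_nonneg fun D' _ => h0 D D')
    simp only [V, Finset.mem_filter, Finset.mem_univ, true_and] at hD
    obtain ⟨hD, hg, hPD, hB⟩ := hD
    obtain ⟨D', e1, e2, e3, e4⟩ := hD.exists_reach_of_not_fixes hb hk hg B hB
    have hD' : D' ∈ W := by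
      simpa [W] using ⟨e3, hP _ _ hPD e4.extends (e3.legal hb)⟩
    refine le_trans ?_ (Finset.single_le_sum (fun D' _ => h0 D D') hD')
    rw [if_pos ⟨by rw [hm]; exact e1, e2⟩]
  have h3 : ∀ D', backSum (weight p q) r D' ≤ ((1 + w) ^ k - 1) * weight p q D' := by
    intro D'
    refine (sum_reach_ne_le hp0 hp1 hq0 hq1 hm0 hw1 hw2 _ D').trans ?_
    refine mul_le_mul_of_nonneg_right (sub_le_sub_right ?_ _) (hμ D')
    rw [length_clauseVars]
    exact pow_le_pow_right₀ (by linarith) (length_firstFalsified_le B _)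
  have h4 : ∑ D ∈ W, weight p q D ≤ prob {ρ : Restriction n n c | P ρ} := by
    calc ∑ D ∈ W, weight p q D = ∑ D ∈ W, (R n c (encode D)).toReal := by
          refine Finset.sum_congr rfl fun D hD => (hR ?_).symm
          simp only [W, Finset.mem_filter] at hD
          exact hD.2.1
      _ = ∑ ρ ∈ W.image encode, (R n c ρ).toReal :=
          by rw [Finset.sum_image fun _ _ _ _ h => encode_injective hb h]
      _ ≤ ∑ ρ with ρ ∈ {ρ : Restriction n n c | P ρ}, (R n c ρ).toReal := by
          refine Finset.sum_le_sum_of_subset_of_nonneg (fun ρ hρ => ?_)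
            fun _ _ _ => ENNReal.toReal_nonneg
          obtain ⟨D, hD, rfl⟩ := Finset.mem_image.1 hρ
          simp only [W, Finset.mem_filter] at hD
          simpa using hD.2.2
      _ = _ := (prob_eq_sum _).symm
  have h5 : prob {ρ : Restriction n n c | P ρ} ≤
      prob {ρ : Restriction n n c | Good ρ ∧ P ρ} + badProb n c := by
    refine (prob_mono fun ρ hρ => ?_).trans (prob_union_le _ _)
    by_cases h : Good ρ
    exacts [.inl ⟨h, hρ⟩, .inr h]
  have h6 : 0 ≤ (1 + w) ^ k - 1 := sub_nonneg.2 (one_le_pow₀ (by linarith))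
  calc prob U ≤ ∑ D' ∈ W, backSum (weight p q) r D' := h1.trans h2
    _ ≤ ∑ D' ∈ W, ((1 + w) ^ k - 1) * weight p q D' := Finset.sum_le_sum fun D' _ => h3 D'
    _ = ((1 + w) ^ k - 1) * ∑ D' ∈ W, weight p q D' := by rw [Finset.mul_sum]
    _ ≤ _ := mul_le_mul_of_nonneg_left (h4.trans h5) h6

end Fixing

/-! ### Numerical estimates -/

/-- With t = n^(1/7) all quantities become integral powers of t, and `10 ^ 7 ≤ n` is what makes t at
least 10. -/
theorem exists_params {n c : ℕ} (hn : 10 ^ 7 ≤ n) (hc : c = ⌊(n : ℝ) ^ (1 / 7 : ℝ)⌋₊) :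
    ∃ t : ℝ, 10 ≤ t ∧ (n : ℝ) ^ (-(1 / 7) : ℝ) = t⁻¹ ∧ (n : ℝ) ^ (-(4 / 7 : ℝ)) = (t ^ 4)⁻¹ ∧
      (n : ℝ) ^ (-(2 / 7 : ℝ)) = (t ^ 2)⁻¹ ∧ (n : ℝ) ^ (3 / 7 : ℝ) = t ^ 3 ∧ (c : ℝ) ≤ t ∧
      t < c + 1 := by
  have h0 : (0 : ℝ) ≤ n := Nat.cast_nonneg n
  have hpow : ∀ j : ℕ, ((n : ℝ) ^ (1 / 7 : ℝ)) ^ j = (n : ℝ) ^ ((1 / 7 : ℝ) * j) := fun j => by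
    rw [Real.rpow_mul h0, Real.rpow_natCast]
  refine ⟨(n : ℝ) ^ (1 / 7 : ℝ), ?_, ?_, ?_, ?_, ?_, ?_, ?_⟩
  · have h1 : ((10 : ℝ) ^ 7) ^ (1 / 7 : ℝ) = 10 := by
      rw [← Real.rpow_natCast, ← Real.rpow_mul (by norm_num)]
      norm_num
    rw [← h1]
    exact Real.rpow_le_rpow (by norm_num) (by exact_mod_cast hn) (by norm_num)
  · rw [Real.rpow_neg h0]
  · rw [Real.rpow_neg h0, hpow]; norm_num
  · rw [Real.rpow_neg h0, hpow]; norm_num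
  · rw [hpow]; norm_num
  · rw [hc]; exact Nat.floor_le (by positivity)
  · rw [hc]; exact Nat.lt_floor_add_one _

theorem colour_ratio_le {t c : ℝ} (ht : 10 ≤ t) (hc : c ≤ t) :
    (t ^ 2)⁻¹ * c / (1 - (t ^ 2)⁻¹) ≤ 100 / 99 * t⁻¹ := by
  have h1 : (t ^ 2)⁻¹ ≤ 1 / 100 := by
    rw [inv_le_comm₀ (by positivity) (by norm_num)]
    nlinarith
  have h2 : (t ^ 2)⁻¹ * c ≤ t⁻¹ := by
    calc (t ^ 2)⁻¹ * c ≤ (t ^ 2)⁻¹ * t := by gcongr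
      _ = t⁻¹ := by field_simp
  rw [div_le_iff₀ (by linarith)]
  have h3 : 0 < t⁻¹ := by positivity
  nlinarith

theorem arrow_ratio_le {t r : ℝ} (ht : 10 ≤ t) (hr : r ≤ 100 / 99 * t⁻¹) :
    (1 + 2 * r) * ((t ^ 4)⁻¹ * (2 * t ^ 3) / (1 - (t ^ 4)⁻¹)) ≤ 3 * t⁻¹ := by
  have h0 : 0 < t⁻¹ := by positivity
  have h1 : (t ^ 4)⁻¹ ≤ 1 / 100 := by
    rw [inv_le_comm₀ (by positivity) (by norm_num)]
    nlinarith [sq_nonneg (t ^ 2 - 100)]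
  have h2 : (t ^ 4)⁻¹ * (2 * t ^ 3) = 2 * t⁻¹ := by field_simp
  have h3 : 2 * t⁻¹ / (1 - (t ^ 4)⁻¹) ≤ 200 / 99 * t⁻¹ := by
    rw [div_le_iff₀ (by linarith)]
    nlinarith
  have h4 : t⁻¹ ≤ 1 / 10 := by
    rw [inv_le_comm₀ (by positivity) (by norm_num)]
    linarith
  have h5 : 0 ≤ 2 * t⁻¹ / (1 - (t ^ 4)⁻¹) := by
    have : 0 ≤ 1 - (t ^ 4)⁻¹ := by linarith
    positivity
  rw [h2]
  calc (1 + 2 * r) * (2 * t⁻¹ / (1 - (t ^ 4)⁻¹))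
      ≤ (1 + 2 * (100 / 99 * (1 / 10))) * (2 * t⁻¹ / (1 - (t ^ 4)⁻¹)) := by
        refine mul_le_mul_of_nonneg_right ?_ h5
        linarith
    _ ≤ (1 + 2 * (100 / 99 * (1 / 10))) * (200 / 99 * t⁻¹) := by gcongr
    _ ≤ 3 * t⁻¹ := by linarith

/-- Comparison with the exponential, using |e^x - 1| ≤ 2|x| for |x| ≤ 1. -/
theorem one_add_pow_sub_one_le {w : ℝ} {k : ℕ} (hw : 0 ≤ w) (h : k * w ≤ 1) :
    (1 + w) ^ k - 1 ≤ 2 * (k * w) := by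
  have h1 : (1 + w) ^ k ≤ Real.exp (k * w) := by
    rw [Real.exp_nat_mul]
    exact pow_le_pow_left₀ (by linarith) (by linarith [Real.add_one_le_exp w]) k
  have h0 : 0 ≤ k * w := by positivity
  have h2 := Real.abs_exp_sub_one_le (x := k * w) (by rwa [abs_of_nonneg h0])
  rw [abs_of_nonneg h0] at h2
  linarith [le_abs_self (Real.exp (k * w) - 1)]

theorem prob_not_fixes_le_of_lt {n c k : ℕ} [NeZero n] [NeZero c] (hn : 10 ^ 7 ≤ n)
    (hb : ∃ β, n = 2 ^ β) (hc : c = ⌊(n : ℝ) ^ (1 / 7 : ℝ)⌋₊)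
    (hk : 12 * (k : ℝ) * (n : ℝ) ^ (-(1 / 7) : ℝ) < 1) (B : KCNF n n c k)
    {P : Restriction n n c → Prop} (hP : ∀ ρ σ, P ρ → Extends σ ρ → Legal σ → P σ) :
    prob {ρ : Restriction n n c | Good ρ ∧ P ρ ∧ ∀ e, ¬ Fixes ρ B.1 e} ≤
      6 * (k : ℝ) * (n : ℝ) ^ (-(1 / 7) : ℝ) *
        (prob {ρ : Restriction n n c | Good ρ ∧ P ρ} + badProb n c) := by
  obtain ⟨t, ht, h1, h4, h2, h3, hct, htc⟩ := exists_params hn hc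
  have hb' : ∃ β, 0 < β ∧ n = 2 ^ β := by
    obtain ⟨β, rfl⟩ := hb
    refine ⟨β, Nat.pos_of_ne_zero ?_, rfl⟩
    rintro rfl
    norm_num at hn
  have ht0 : 0 < t := by linarith
  rw [h1] at hk ⊢
  have hkt : 12 * (k : ℝ) < t := by
    rwa [← div_eq_mul_inv, div_lt_one ht0] at hk
  -- From 12k < t, t < c + 1 and t ≥ 10; this is the room needed for an unmentioned colour.
  have hkc : k < c := by
    have : (k : ℝ) < c := by linarith
    exact_mod_cast this
  have hr := colour_ratio_le ht hct
  have hinv : 0 < t⁻¹ := by positivity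
  have hlt : ∀ j : ℕ, j ≠ 0 → (t ^ j)⁻¹ < 1 := fun j hj =>
    inv_lt_one_of_one_lt₀ (one_lt_pow₀ (by linarith) hj)
  have key := prob_not_fixes_le hb' hkc B hP (w := 3 * t⁻¹) h4.symm h2.symm
    (by rw [h3] : 2 * t ^ 3 = _) (hlt 4 (by norm_num)) (hlt 2 (by norm_num)) (by linarith)
    (arrow_ratio_le ht hr)
  have h5 := one_add_pow_sub_one_le (w := 3 * t⁻¹) (k := k) (by positivity) (by linarith)
  refine key.trans (mul_le_mul_of_nonneg_right (by linarith) ?_)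
  exact add_nonneg (prob_nonneg _) (prob_nonneg _)

/-! ### Decision trees -/

theorem DecisionTree.exists_label {α : Type} {h : ℕ} (T : DecisionTree α h) (z : List Bool)
    (hz : z.length < h) : ∃ B, ∀ e, T.queries (z ++ [e]) = T.queries z ++ [(B, e)] := by
  induction T generalizing z with
  | leaf => simp at hz
  | node B no yes ihn ihy =>
    rcases z with _ | ⟨t, z⟩
    · refine ⟨B, fun e => ?_⟩
      cases e <;> simp only [List.nil_append, queries] <;> congr 1
      · cases no <;> rfl
      · cases yes <;> rfl
    · have hz' : z.length < _ := Nat.lt_of_succ_lt_succ hz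
      cases t
      · obtain ⟨B', h'⟩ := ihn z hz'
        exact ⟨B', fun e => by simp only [List.cons_append, queries, h']⟩
      · obtain ⟨B', h'⟩ := ihy z hz'
        exact ⟨B', fun e => by simp only [List.cons_append, queries, h']⟩

/-! ### Fixing along the branches of a tree. -/

section

variable {n c k h : ℕ} [NeZero n]

theorem Fixes.of_extends {ρ σ : Restriction n n c} {B : CNF n n c} {e : Bool} (hρ : Fixes ρ B e)
    (hσ : Extends σ ρ) : Fixes σ B e := by
  cases e
  · obtain ⟨C, hC, hf⟩ := hρ
    exact ⟨C, hC, fun l hl => hσ _ _ (hf l hl)⟩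
  · exact fun τ hτ => hρ τ fun v t hv => hτ v t (hσ v t hv)

theorem Fixes.unique {ρ : Restriction n n c} (hρ : Legal ρ) {B : CNF n n c} {e e' : Bool}
    (h₁ : Fixes ρ B e) (h₂ : Fixes ρ B e') : e = e' := by
  cases e <;> cases e'
  · rfl
  · exact absurd h₁ (h₂ ρ (fun _ _ h => h) hρ)
  · exact absurd h₂ (h₁ ρ (fun _ _ h => h) hρ)
  · rfl

/-- A legal restriction cannot fix a CNF to both values, so the answers agree all the way down. This
makes the compatibility events at one depth disjoint. -/
theorem DecisionTree.fixes_unique {ρ : Restriction n n c} (hρ : Legal ρ)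
    (T : DecisionTree (KCNF n n c k) h) {z z' : List Bool} (hz : z.length ≤ h)
    (hzz' : z.length = z'.length) (h₁ : ∀ Q ∈ T.queries z, Fixes ρ Q.1.1 Q.2)
    (h₂ : ∀ Q ∈ T.queries z', Fixes ρ Q.1.1 Q.2) : z = z' := by
  induction T generalizing z z' with
  | leaf =>
    rw [List.eq_nil_of_length_eq_zero (Nat.le_zero.1 hz)] at hzz' ⊢
    exact (List.eq_nil_of_length_eq_zero hzz'.symm).symm
  | node B no yes ihn ihy =>
    rcases z with _ | ⟨t, z⟩ <;> rcases z' with _ | ⟨t', z'⟩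
    · rfl
    · simp at hzz'
    · simp at hzz'
    · have hz1 : z.length ≤ _ := Nat.le_of_succ_le_succ hz
      have hz2 : z.length = z'.length := Nat.succ.inj hzz'
      have key : ∀ e y, ∃ L, (DecisionTree.node B no yes).queries (e :: y) = (B, e) :: L := by
        intro e y
        cases e <;> exact ⟨_, rfl⟩
      have ht : t = t' := by
        obtain ⟨L, hL⟩ := key t z
        obtain ⟨L', hL'⟩ := key t' z'
        exact (h₁ (B, t) (by rw [hL]; simp)).unique hρ (h₂ (B, t') (by rw [hL']; simp))
      subst ht
      congr 1
      cases t
      · exact ihn hz1 hz2 (fun Q hQ => h₁ Q (List.mem_cons_of_mem _ hQ))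
          fun Q hQ => h₂ Q (List.mem_cons_of_mem _ hQ)
      · exact ihy hz1 hz2 (fun Q hQ => h₁ Q (List.mem_cons_of_mem _ hQ))
          fun Q hQ => h₂ Q (List.mem_cons_of_mem _ hQ)

end

/-! ### The loss per level, and the induction on the depth. -/

section

variable {n c k h : ℕ} [NeZero n] [NeZero c]

theorem prob_compatible_not_fixes_le (hn : 10 ^ 7 ≤ n) (hb : ∃ β, n = 2 ^ β)
    (hc : c = ⌊(n : ℝ) ^ (1 / 7 : ℝ)⌋₊)
    (hk : 12 * (k : ℝ) * (n : ℝ) ^ (-(1 / 7) : ℝ) < 1) (T : DecisionTree (KCNF n n c k) h)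
    {z : List Bool} (hz : Big T z) (B : KCNF n n c k) :
    prob {ρ : Restriction n n c | Compatible T z ρ ∧ ∀ e, ¬ Fixes ρ B.1 e} ≤
      12 * (k : ℝ) * (n : ℝ) ^ (-(1 / 7) : ℝ) *
        prob {ρ : Restriction n n c | Compatible T z ρ} := by
  have key := prob_not_fixes_le_of_lt hn hb hc hk B
    (P := fun ρ => ∀ Q ∈ T.queries z, Fixes ρ Q.1.1 Q.2)
    fun ρ σ hρ hσ _ Q hQ => (hρ Q hQ).of_extends hσ
  have h0 : 0 ≤ 6 * (k : ℝ) * (n : ℝ) ^ (-(1 / 7) : ℝ) := by positivity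
  calc prob {ρ : Restriction n n c | Compatible T z ρ ∧ ∀ e, ¬ Fixes ρ B.1 e}
      ≤ 6 * (k : ℝ) * (n : ℝ) ^ (-(1 / 7) : ℝ) *
        (prob {ρ : Restriction n n c | Compatible T z ρ} + badProb n c) := by
        refine le_trans (prob_mono fun ρ hρ => ?_) key
        exact ⟨hρ.1.1, hρ.1.2, hρ.2⟩
    _ ≤ 6 * (k : ℝ) * (n : ℝ) ^ (-(1 / 7) : ℝ) *
        (prob {ρ : Restriction n n c | Compatible T z ρ} +
          prob {ρ : Restriction n n c | Compatible T z ρ}) := by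
        have := le_of_lt hz
        gcongr
    _ = _ := by ring

/-- A restriction compatible with a big node either fails to fix its label, or passes to a child
that is big or not big. The three cases give the three terms on the right. -/
theorem prob_bigSet_le_succ (hn : 10 ^ 7 ≤ n) (hb : ∃ β, n = 2 ^ β)
    (hc : c = ⌊(n : ℝ) ^ (1 / 7 : ℝ)⌋₊) (T : DecisionTree (KCNF n n c k) h) {d : ℕ} (hd : d < h) :
    prob (bigSet T d) ≤ prob (bigSet T (d + 1)) + 12 * (k : ℝ) * (n : ℝ) ^ (-(1 / 7) : ℝ) +
      2 ^ (d + 1) * badProb n c := by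
  classical
  have hε : 0 ≤ badProb n c := prob_nonneg _
  -- If this quantity is at least 1, the bound is trivial; otherwise `k` is small enough for the
  -- switching estimate. Hence the threshold for `n` does not depend on `k`.
  rcases le_or_gt 1 (12 * (k : ℝ) * (n : ℝ) ^ (-(1 / 7) : ℝ)) with hk | hk
  · have h1 : prob (bigSet T d) ≤ 1 := prob_univ (n := n) (c := c) ▸ prob_mono (Set.subset_univ _)
    have h2 := prob_nonneg (bigSet T (d + 1))
    have h3 : 0 ≤ 2 ^ (d + 1) * badProb n c := by positivity
    linarith
  have hB : ∀ z : List.Vector Bool d, ∃ B, ∀ e,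
      T.queries (z.1 ++ [e]) = T.queries z.1 ++ [(B, e)] :=
    fun z => T.exists_label z.1 (by rw [z.2]; exact hd)
  choose B hB using hB
  let s : Finset (List.Vector Bool d) := Finset.univ.filter fun z => Big T z.1
  let s' : Finset (List.Vector Bool (d + 1)) := Finset.univ.filter fun z => ¬ Big T z.1
  let U : List.Vector Bool d → Set (Restriction n n c) := fun z =>
    {ρ | Compatible T z.1 ρ ∧ ∀ e, ¬ Fixes ρ (B z).1 e}
  have hsub : bigSet T d ⊆ bigSet T (d + 1) ∪ (⋃ z ∈ s, U z) ∪
      ⋃ z ∈ s', {ρ : Restriction n n c | Compatible T z.1 ρ} := by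
    rintro ρ ⟨hg, z, hz, hbig, hcomp⟩
    by_cases hfix : ∃ e, Fixes ρ (B ⟨z, hz⟩).1 e
    · obtain ⟨e, he⟩ := hfix
      have hz' : (z ++ [e]).length = d + 1 := by simp [hz]
      have hcomp' : Compatible T (z ++ [e]) ρ := by
        refine ⟨hg, fun Q hQ => ?_⟩
        rw [hB ⟨z, hz⟩ e, List.mem_append, List.mem_singleton] at hQ
        rcases hQ with hQ | rfl
        exacts [hcomp.2 Q hQ, he]
      by_cases hbig' : Big T (z ++ [e])
      · exact .inl (.inl ⟨hg, _, hz', hbig', hcomp'⟩)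
      · refine .inr ?_
        simp only [Set.mem_iUnion]
        exact ⟨⟨z ++ [e], hz'⟩, Finset.mem_filter.2 ⟨Finset.mem_univ _, hbig'⟩, hcomp'⟩
    · push Not at hfix
      refine .inl (.inr ?_)
      simp only [Set.mem_iUnion]
      exact ⟨⟨z, hz⟩, Finset.mem_filter.2 ⟨Finset.mem_univ _, hbig⟩, hcomp, hfix⟩
  have h1 : prob (⋃ z ∈ s, U z) ≤ 12 * (k : ℝ) * (n : ℝ) ^ (-(1 / 7) : ℝ) := by
    calc prob (⋃ z ∈ s, U z) ≤ ∑ z ∈ s, prob (U z) := prob_biUnion_le _ _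
      _ ≤ ∑ z ∈ s, 12 * (k : ℝ) * (n : ℝ) ^ (-(1 / 7) : ℝ) *
          prob {ρ : Restriction n n c | Compatible T z.1 ρ} := by
        refine Finset.sum_le_sum fun z hz => ?_
        exact prob_compatible_not_fixes_le hn hb hc hk T (by simpa [s] using hz) (B z)
      _ = 12 * (k : ℝ) * (n : ℝ) ^ (-(1 / 7) : ℝ) *
          ∑ z ∈ s, prob {ρ : Restriction n n c | Compatible T z.1 ρ} := by rw [Finset.mul_sum]
      _ ≤ 12 * (k : ℝ) * (n : ℝ) ^ (-(1 / 7) : ℝ) * 1 := by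
        refine mul_le_mul_of_nonneg_left (sum_prob_le_one _ _ ?_) (by positivity)
        intro z _ z' _ ρ hz hz'
        exact Subtype.ext (T.fixes_unique hz.1.legal (by rw [z.2]; exact hd.le)
          (by rw [z.2, z'.2]) hz.2 hz'.2)
      _ = _ := mul_one _
  have h2 : prob (⋃ z ∈ s', {ρ : Restriction n n c | Compatible T z.1 ρ}) ≤
      2 ^ (d + 1) * badProb n c := by
    calc prob (⋃ z ∈ s', {ρ : Restriction n n c | Compatible T z.1 ρ})
        ≤ ∑ z ∈ s', prob {ρ : Restriction n n c | Compatible T z.1 ρ} := prob_biUnion_le _ _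
      _ ≤ ∑ z ∈ s', badProb n c := Finset.sum_le_sum fun z hz => by
          simpa [s', Big] using hz
      _ = s'.card * badProb n c := by rw [Finset.sum_const, nsmul_eq_mul]
      _ ≤ 2 ^ (d + 1) * badProb n c := by
        refine mul_le_mul_of_nonneg_right ?_ hε
        have : s'.card ≤ 2 ^ (d + 1) := by
          refine (Finset.card_le_univ s').trans_eq ?_
          rw [card_vector, Fintype.card_bool]
        exact_mod_cast this
  have h3 := prob_mono hsub
  have h4 := prob_union_le (bigSet T (d + 1) ∪ ⋃ z ∈ s, U z)
    (⋃ z ∈ s', {ρ : Restriction n n c | Compatible T z.1 ρ})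
  have h5 := prob_union_le (bigSet T (d + 1)) (⋃ z ∈ s, U z)
  linarith

/-- Every good restriction is compatible with the root, and the root is big because 1 - ε > ε. -/
theorem one_sub_badProb_le_bigSet_zero (T : DecisionTree (KCNF n n c k) h)
    (hε : 2 * badProb n c < 1) : 1 - badProb n c ≤ prob (bigSet T 0) := by
  have hq : T.queries [] = [] := by cases T <;> rfl
  have h1 : 1 - badProb n c ≤ prob {ρ : Restriction n n c | Good ρ} := by
    have h := prob_union_le {ρ : Restriction n n c | Good ρ} {ρ | ¬ Good ρ}
    have h' : {ρ : Restriction n n c | Good ρ} ∪ {ρ | ¬ Good ρ} = Set.univ :=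
      Set.eq_univ_of_forall fun ρ => em (Good ρ)
    rw [h', prob_univ] at h
    simp only [badProb] at *
    linarith
  have hcomp : ∀ ρ : Restriction n n c, Good ρ → Compatible T [] ρ := fun ρ hρ =>
    ⟨hρ, by simp [hq]⟩
  have hbig : Big T [] := by
    have : prob {ρ : Restriction n n c | Good ρ} ≤
      prob {ρ : Restriction n n c | Compatible T [] ρ} := prob_mono hcomp
    unfold Big
    linarith
  exact h1.trans (prob_mono fun ρ hρ => ⟨hρ, [], rfl, hbig, hcomp ρ hρ⟩)

/-- The coefficient of ε is 1 + (2 + 4 + ... + 2^d) = 2^(d+1) - 1: the root costs ε, and the step to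
depth j costs 2^j ε. -/
theorem le_prob_bigSet (hn : 10 ^ 7 ≤ n) (hb : ∃ β, n = 2 ^ β)
    (hc : c = ⌊(n : ℝ) ^ (1 / 7 : ℝ)⌋₊) (T : DecisionTree (KCNF n n c k) h)
    (hε : 2 * badProb n c < 1) {d : ℕ} (hd : d ≤ h) :
    1 - (d : ℝ) * (12 * (k : ℝ) * (n : ℝ) ^ (-(1 / 7) : ℝ)) - (2 ^ (d + 1) - 1) * badProb n c ≤
      prob (bigSet T d) := by
  induction d with
  | zero =>
    have := one_sub_badProb_le_bigSet_zero T hε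
    norm_num
    linarith
  | succ d ih =>
    have h1 := ih (by omega)
    have h2 := prob_bigSet_le_succ hn hb hc T (d := d) (by omega)
    push_cast
    rw [pow_succ]
    linarith

end

end CPLS

theorem mainTheorem7 :
    ∃ N : ℕ, ∀ (n c : ℕ) [NeZero n] [NeZero c], N ≤ n →
      (∃ β : ℕ, n = 2 ^ β) → (∃ γ : ℕ, c = 2 ^ γ) → c = ⌊(n : ℝ) ^ (1 / 7 : ℝ)⌋₊ →
      ∀ (k h : ℕ) (T : CPLS.DecisionTree (CPLS.KCNF n n c k) h) (d : ℕ), d ≤ h →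
        1 - (d : ℝ) * (12 * (k : ℝ) * (n : ℝ) ^ (-(1 / 7) : ℝ))
            - (2 : ℝ) ^ (d + 1) * CPLS.badProb n c
          ≤ CPLS.prob (CPLS.bigSet T d) := by
  refine ⟨10 ^ 7, ?_⟩
  intro n c _ _ hn hb _ hc k h T d hd
  have hε : 0 ≤ CPLS.badProb n c := CPLS.prob_nonneg _
  rcases lt_or_ge (2 * CPLS.badProb n c) 1 with h1 | h1
  · have := CPLS.le_prob_bigSet hn hb hc T h1 hd
    linarith
  -- When 2ε ≥ 1 the root need not be big, but then 2^(d+1) ε ≥ 1 and the lower bound is not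
  -- positive.
  · have h2 := CPLS.prob_nonneg (CPLS.bigSet T d)
    have h3 : (0 : ℝ) ≤ (d : ℝ) * (12 * (k : ℝ) * (n : ℝ) ^ (-(1 / 7) : ℝ)) := by positivity
    have h4 : 2 * CPLS.badProb n c ≤ (2 : ℝ) ^ (d + 1) * CPLS.badProb n c := by
      refine mul_le_mul_of_nonneg_right ?_ hε
      exact le_self_pow₀ (by norm_num) (by omega)
    linarith
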